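/- **Setting.** Let $m\ge 2$ agents form a connected network and let $f(x)=\frac1m\sum_{i=1}^m f_i(x)$, $f_i(x)=\frac1n\sum_{j=1}^n f_{i,j}(x)$ for $x\in\mathbb R^d$, with $n\ge1$ and differentiable $f_{i,j}:\mathbb R^d\to\mathbb R$. Assume: * $W\in\mathbb R^{m\times m}$ is symmetric, $w_{ij}=0$ whenever $i\ne j$ are not adjacent in the network, $W\mathbf 1=\mathbf 1$, $W$ is positive semidefinite, and its second-largest eigenvalue (with multiplicity) satisfies $\lambda_2(W)<1$; * $f^*=\inf_x f(x)>-\infty$; * for some $L>0$, $\frac1n\sum_{j=1}^n\|\nabla f_{i,j}(x)-\nabla f_{i,j}(x')\|^2\le L^2\|x-x'\|^2$ for all agents $i$ and all $x,x'\in\mathbb R^d$. For $\mathbf x\in\mathbb R^{m\times d}$ with rows $\mathbf x(i)$ let $\nabla\mathbf f(\mathbf x)$ have the rows $\nabla f_i(\mathbf x(i))$, and let a bar denote the mean of the rows. $\mathtt{FastMix}(\mathbf u,K)$ returns $\mathbf u^{(K)}$, where $\mathbf u^{(-1)}=\mathbf u^{(0)}=\mathbf u$, $\mathbf u^{(k+1)}=(1+\eta_u)W\mathbf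 u^{(k)}-\eta_u\mathbf u^{(k-1)}$ and $\eta_u=\frac{1-\sqrt{1-\lambda_2^2(W)}}{1+\sqrt{1-\lambda_2^2(W)}}$; it takes $K$ communication rounds. **Algorithm (DEAREST).** Given $\bar x_0\in\mathbb R^d$, put $\mathbf x_0=\mathbf 1\bar x_0$, $\mathbf g_0=\nabla\mathbf f(\mathbf x_0)$, $\mathbf s_0=\mathtt{FastMix}(\mathbf g_0,K_{\rm in})$. For $t=0,\dots,T-1$ draw $y_t\sim{\rm Bernoulli}(p)$ (shared by all agents), let $K_t=K$ if $y_t=1$ and $K_t=\hat K$ otherwise, and set $\mathbf x_{t+1}=\mathtt{FastMix}(\mathbf x_t-\eta\mathbf s_t,K_t)$; for each $i$, $\mathbf g_{t+1}(i)=\nabla f_i(\mathbf x_{t+1}(i))$ if $y_t=1$, and otherwise $\mathbf g_{t+1}(i)=\mathbf g_t(i)+\frac1b\sum_{j=1}^b\big(\nabla f_{i,\xi_j}(\mathbf x_{t+1}(i))-\nabla f_{i,\xi_j}(\mathbf x_t(i))\big)$ with fresh indices $\xi_1,\dots,\xi_b$ (for each $t$ and $i$) drawn independently and uniformly from $\{1,\dots,n\}$;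 then $\mathbf s_{t+1}=\mathtt{FastMix}(\mathbf s_t+\mathbf g_{t+1}-\mathbf g_t,K_t)$. The output $x_{\rm out}$ is drawn uniformly, and independently of the rest, from $\{\mathbf x_t(i):0\le t\le T-1,\ 1\le i\le m\}$. An IFO call is one evaluation of some $\nabla f_{i,j}$ at one point. **Theorem.** There is an absolute constant $C>0$ such that the following holds in this setting. Let $\varepsilon>0$, $\Delta=f(\bar x_0)-f^*>0$, $H=\frac1m\|\mathbf g_0-\mathbf 1\bar g_0\|^2$, and run DEAREST with $$\eta=\frac1{2L},\quad b=\Big\lceil 6\sqrt{n/m}\,\Big\rceil,\quad p=\frac b{b+n},\quad T=\Big\lceil\frac{16L\Delta}{\varepsilon^2}\Big\rceil,$$ $$K=\left\lceil\frac{\max\{12,\log((\sqrt{mn}+6)/(24m))\}}{2\sqrt{1-\lambda_2(W)}}\right\rceil,\quad \hat K=\left\lceil\frac6{\sqrt{1-\lambda_2(W)}}\right\rceil,\quad K_{\rm in}=\left\lceil\frac{\log(H/\varepsilon^2)}{\sqrt{1-\lambda_2(W)}}\right\rceil,$$ where $K_{\rm in}$ is read as $0$ if $H=0$ or if the right-hand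 side is negative. Then: 1. $\mathbb E\|\nabla f(x_{\rm out})\|\le\varepsilon$. 2. The expected number of IFO calls of each agent is at most $C\big(n+\max\{1,\sqrt{n/m}\}\,L\Delta\varepsilon^{-2}\big)$. 3. The expected number of communication rounds is at most $C\big(L\Delta\varepsilon^{-2}+\max\{0,\log(H/\varepsilon^2)\}+1\big)/\sqrt{1-\lambda_2(W)}$. 4. For every $\kappa\ge1$ with $\Delta\le\kappa$: if $m\le\kappa n$, the expected number of IFO calls of each agent is at most $C\kappa^2\big(n+\sqrt{n/m}\,L\varepsilon^{-2}\big)$; if $H\le\kappa L$ and $\varepsilon^2\le\kappa L$, the expected number of communication rounds is at most $C\kappa^2L\varepsilon^{-2}/\sqrt{1-\lambda_2(W)}$. That is, these numbers are $\mathcal O\big(n+\sqrt{n/m}\,L\varepsilon^{-2}\big)$ and $\mathcal O\big(L\varepsilon^{-2}/\sqrt{1-\lambda_2(W)}\big)$, with hidden constants that depend only on $\kappa$. -/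

import Mathlib

open scoped BigOperators Gradient

namespace Dearest

noncomputable section

/-- Vectors of `ℝ^d` with the Euclidean norm. -/
abbrev Vec (d : ℕ) := EuclideanSpace ℝ (Fin d)

/-- Aggregate variables in `ℝ^{m × d}`: one row in `ℝ^d` for each agent. -/
abbrev Agg (m d : ℕ) := Fin m → Vec d

/-- The mean `ū = (1/m) ∑ i, u(i)` of the rows. -/
def mean {m d : ℕ} (u : Agg m d) : Vec d := (1 / (m : ℝ)) • ∑ i, u i

/-- The squared Frobenius norm `‖u - 𝟏 ū‖²`. -/
def consensusErrorSq {m d : ℕ} (u : Agg m d) : ℝ := ∑ i, ‖u i - mean u‖ ^ 2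

/-- The local function `f_i = (1/n) ∑ j, f_{i,j}`. -/
def localFn {m n d : ℕ} (f : Fin m → Fin n → Vec d → ℝ) (i : Fin m) (x : Vec d) : ℝ :=
  (1 / (n : ℝ)) * ∑ j, f i j x

/-- The global objective `f = (1/m) ∑ i, f_i`. -/
def globalFn {m n d : ℕ} (f : Fin m → Fin n → Vec d → ℝ) (x : Vec d) : ℝ :=
  (1 / (m : ℝ)) * ∑ i, localFn f i x

/-- `L`-average smoothness of the (differentiable) individual functions on each agent. -/
def AverageSmooth {m n d : ℕ} (f : Fin m → Fin n → Vec d → ℝ) (L : ℝ) : Prop :=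
  ∀ (i : Fin m) (x x' : Vec d),
    (1 / (n : ℝ)) * ∑ j, ‖∇ (f i j) x - ∇ (f i j) x'‖ ^ 2 ≤ L ^ 2 * ‖x - x'‖ ^ 2

/-- The aggregate gradient `∇𝐟(x)`, with rows `∇f_i(x(i))`. -/
def aggGrad {m n d : ℕ} (f : Fin m → Fin n → Vec d → ℝ) (x : Agg m d) : Agg m d :=
  fun i => ∇ (localFn f i) (x i)

/-- The second-largest eigenvalue of a real symmetric matrix, counted with multiplicity: the
second entry of the decreasingly sorted list of the roots of the characteristic polynomial. -/
def lambda2 {m : ℕ} (W : Matrix (Fin m) (Fin m) ℝ) : ℝ :=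
  (W.charpoly.roots.sort (· ≥ ·)).getD 1 0

/-- The product `W u`: each agent forms a weighted sum of the rows of its neighbours. -/
def gossip {m d : ℕ} (W : Matrix (Fin m) (Fin m) ℝ) (u : Agg m d) : Agg m d :=
  fun i => ∑ j, W i j • u j

/-- The momentum parameter of `FastMix`. -/
def etaU {m : ℕ} (W : Matrix (Fin m) (Fin m) ℝ) : ℝ :=
  (1 - √(1 - lambda2 W ^ 2)) / (1 + √(1 - lambda2 W ^ 2))

/-- The pair `(u^{(k)}, u^{(k-1)})` of the `FastMix` recursion started at `u^{(0)} = u^{(-1)} = u`. -/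
def fastMixPair {m d : ℕ} (W : Matrix (Fin m) (Fin m) ℝ) (u : Agg m d) : ℕ → Agg m d × Agg m d
  | 0 => (u, u)
  | k + 1 =>
    let v := fastMixPair W u k
    ((1 + etaU W) • gossip W v.1 - etaU W • v.2, v.1)

/-- `FastMix(u, K)`, which returns `u^{(K)}`; it takes `K` rounds of communication. -/
def fastMix {m d : ℕ} (W : Matrix (Fin m) (Fin m) ℝ) (u : Agg m d) (K : ℕ) : Agg m d :=
  (fastMixPair W u K).1

/-- The inputs of the algorithm, besides the problem and the initial point: stepsize,
probability, mini-batch size, number of iterations and numbers of communication rounds. -/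
structure Params where
  (η : ℝ)
  (p : ℝ)
  (b : ℕ)
  (T : ℕ)
  (K : ℕ)
  (Khat : ℕ)
  (Kin : ℕ)

/-- The state of the algorithm: the iterates `x_t`, `g_t`, `s_t`, the number of IFO calls
(evaluations of a gradient `∇f_{i,j}` at a point) made so far by each agent, and the number of
communication rounds made so far. -/
structure State (m d : ℕ) where
  (x : Agg m d)
  (g : Agg m d)
  (s : Agg m d)
  (ifo : Fin m → ℕ)
  (comm : ℕ)

/-- The randomness of one iteration: the Bernoulli variable `y_t`, shared by all agents, and the
indices `ξ_{i,1}, …, ξ_{i,b}` drawn by each agent `i`. -/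
abbrev Noise (m n b : ℕ) := Bool × (Fin m → Fin b → Fin n)

/-- Initialization; the full gradient costs each agent `n` IFO calls. -/
def initState {m n d : ℕ} (f : Fin m → Fin n → Vec d → ℝ) (W : Matrix (Fin m) (Fin m) ℝ)
    (x₀ : Vec d) (P : Params) : State m d where
  x := fun _ => x₀
  g := aggGrad f fun _ => x₀
  s := fastMix W (aggGrad f fun _ => x₀) P.Kin
  ifo := fun _ => n
  comm := P.Kin

/-- One iteration. The full gradient of an agent costs `n` IFO calls, the mini-batch correction
costs `2 b`; `FastMix` is called twice with `K_t` rounds each. -/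
def step {m n d : ℕ} (f : Fin m → Fin n → Vec d → ℝ) (W : Matrix (Fin m) (Fin m) ℝ)
    (P : Params) (z : Noise m n P.b) (S : State m d) : State m d :=
  let Kt : ℕ := if z.1 then P.K else P.Khat
  let x' : Agg m d := fastMix W (S.x - P.η • S.s) Kt
  let g' : Agg m d := fun i =>
    if z.1 then ∇ (localFn f i) (x' i)
    else S.g i + (1 / (P.b : ℝ)) •
      ∑ j : Fin P.b, (∇ (f i (z.2 i j)) (x' i) - ∇ (f i (z.2 i j)) (S.x i))
  { x := x'
    g := g'
    s := fastMix W (S.s + g' - S.g) Kt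
    ifo := fun i => S.ifo i + if z.1 then n else 2 * P.b
    comm := S.comm + 2 * Kt }

/-- The state after `t ≤ T` iterations, for a realization `ω` of the randomness of the `T`
iterations. -/
def run {m n d : ℕ} (f : Fin m → Fin n → Vec d → ℝ) (W : Matrix (Fin m) (Fin m) ℝ)
    (x₀ : Vec d) (P : Params) (ω : Fin P.T → Noise m n P.b) : ℕ → State m d
  | 0 => initState f W x₀ P
  | t + 1 =>
    if h : t < P.T then step f W P (ω ⟨t, h⟩) (run f W x₀ P ω t) else run f W x₀ P ω t

/-- The sample space of a whole execution: the randomness of the `T` iterations and the index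
`(t, i)` of the output. -/
abbrev Sample (m n : ℕ) (P : Params) := (Fin P.T → Noise m n P.b) × (Fin P.T × Fin m)

/-- The probability of an outcome: all the `y_t` (Bernoulli with parameter `p`), all the `ξ`
(uniform on `n` indices) and the output index (uniform on `T m` pairs) are independent. -/
def prob {m n : ℕ} (P : Params) (ω : Sample m n P) : ℝ :=
  (∏ t : Fin P.T, ((if (ω.1 t).1 then P.p else 1 - P.p) *
    ∏ _i : Fin m, ∏ _j : Fin P.b, (1 / (n : ℝ)))) * (1 / ((P.T : ℝ) * (m : ℝ)))

/-- Expectation of a random variable on the (finite) sample space. -/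
def expect {m n : ℕ} (P : Params) (X : Sample m n P → ℝ) : ℝ := ∑ ω, prob P ω * X ω

/-- The output `x_out = x_t(i)`. -/
def xOut {m n d : ℕ} (f : Fin m → Fin n → Vec d → ℝ) (W : Matrix (Fin m) (Fin m) ℝ)
    (x₀ : Vec d) (P : Params) (ω : Sample m n P) : Vec d :=
  (run f W x₀ P ω.1 (ω.2.1 : ℕ)).x ω.2.2

/-- The number of IFO calls made by agent `i` in a whole execution. -/
def ifoCalls {m n d : ℕ} (f : Fin m → Fin n → Vec d → ℝ) (W : Matrix (Fin m) (Fin m) ℝ)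
    (x₀ : Vec d) (P : Params) (i : Fin m) (ω : Sample m n P) : ℕ :=
  (run f W x₀ P ω.1 P.T).ifo i

/-- The number of communication rounds of a whole execution. -/
def commRounds {m n d : ℕ} (f : Fin m → Fin n → Vec d → ℝ) (W : Matrix (Fin m) (Fin m) ℝ)
    (x₀ : Vec d) (P : Params) (ω : Sample m n P) : ℕ :=
  (run f W x₀ P ω.1 P.T).comm

end

end Dearest

/-!
Write `e` and `q` for the consensus errors of the iterates and of the gradient trackers, `V` for
the error of the local gradient estimators, and `U` for the error of their mean.

*Mixing.* In an eigenbasis of `W`, `FastMix` is a scalar three-term recursion on each eigenvalue. On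
`𝟏` it is constant, so it preserves means. The other eigenvalues lie in `[0, λ₂]`, and the momentum
makes `λ₂` a double root of the characteristic equation, so all these components decay like
scaled Chebyshev polynomials; this gives the accelerated contraction
`consensusErrorSq_fastMix_le`. With at least `6 / √(1 - λ₂)` rounds the squared consensus error
shrinks by a factor of `100`.

*One iteration.* Gradient tracking keeps the mean of the trackers equal to the mean of the gradient
estimators, so the mean iterate makes a gradient step with an error controlled by `U` and `e`. With
probability `p` the estimators are refreshed and `U`, `V` vanish; otherwise they grow by the
variance of the mini-batches, which is proportional to the squared displacement of the iterates
and, for `U`, smaller by the factor `m b` since the agents sample independently. As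
`(1 - p) / (p m b) = n / (m b²) ≤ 1 / 36`, all these errors are absorbed in a weighted sum with the
objective, the `lyapunov` function, which decreases in expectation by
`‖∇f(x̄)‖² / (4 L) + L e / 4` (`lyapunov_step_le`).

*Conclusion.* Iterations are chained through the Markov property `runExp_succ`, an instance of the
resampling identity `prodExp_resample` for product weights, which also yields the variance of sums
of independent terms. Summing the decrease over `T ≥ 16 L Δ / ε²` iterations bounds the gradient at
a uniformly chosen iterate (`expect_norm_gradient_xOut_le`). The expected costs are exact linear
functions of `T`; they are estimated with `p n ≤ b`, with `p ℓ ≤ 1` for the positive part `ℓ` of the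
logarithm in `K`, and with roundings up absorbed by `√(1 - λ₂) ≤ 1`.
-/

namespace Dearest

noncomputable section

/-! ### `FastMix` on one eigenvalue -/

/-- The pair `(a_k, a_{k-1})` of the `FastMix` recursion with momentum `η`, run on a single
eigenvalue `lam` of the gossip matrix and started at `a_0 = a_{-1} = 1`. -/
def scalarMix (η lam : ℝ) : ℕ → ℝ × ℝ
  | 0 => (1, 1)
  | k + 1 => ((1 + η) * lam * (scalarMix η lam k).1 - η * (scalarMix η lam k).2,
      (scalarMix η lam k).1)

lemma scalarMix_one (η : ℝ) (k : ℕ) : scalarMix η 1 k = (1, 1) := by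
  induction k with
  | zero => rfl
  | succ k ih => simp [scalarMix, ih]

/-- The scaled Chebyshev polynomials `U = r^k U_k(c)` and `w = r^k (U_k(c) - U_{k-1}(c))`, with
`2 r c = (1 + η) lam`, express the scalar recursion. The quadratic form is its conserved energy. -/
lemma exists_chebyshev_scalarMix {η lam r : ℝ} (hr : 0 < r) (hη : η = r ^ 2) (hlam : 0 ≤ lam)
    (hlam' : (1 + η) * lam ≤ 2 * r) (k : ℕ) :
    ∃ w U : ℝ, (scalarMix η lam k).1 = (1 - r) * U + r * w ∧
      η * (scalarMix η lam k).2 =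
        r * (1 - r) * (U - w) + r * (r * w + (2 * r - (1 + η) * lam) * (U - w)) ∧
      r * w ^ 2 + (2 * r - (1 + η) * lam) * (U ^ 2 - U * w) = r ^ (2 * k + 1) ∧
      |w| ≤ √2 * r ^ k ∧ |U| ≤ √2 * (k + 1) * r ^ k := by
  set δ := 2 * r - (1 + η) * lam with hδ
  have hη0 : 0 ≤ η := hη ▸ sq_nonneg r
  have hδ0 : 0 ≤ δ := by linarith
  have hδ2 : δ ≤ 2 * r := by
    have : 0 ≤ (1 + η) * lam := by positivity
    linarith
  have hmul : (1 + η) * lam = 2 * r - δ := by rw [hδ]; ring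
  have key : ∀ (k : ℕ) (w U : ℝ), r * w ^ 2 + δ * (U ^ 2 - U * w) = r ^ (2 * k + 1) →
      |w| ≤ √2 * r ^ k := by
    intro k w U h
    have h1 : r * w ^ 2 ≤ r * (2 * (r ^ k) ^ 2) := by
      have e : r ^ (2 * k + 1) = r * (r ^ k) ^ 2 := by ring
      have h2 : -(w ^ 2 / 4) ≤ U ^ 2 - U * w := by nlinarith [sq_nonneg (U - w / 2)]
      have h3 : δ * (-(w ^ 2 / 4)) ≤ δ * (U ^ 2 - U * w) := mul_le_mul_of_nonneg_left h2 hδ0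
      have h4 : δ * (w ^ 2 / 4) ≤ 2 * r * (w ^ 2 / 4) :=
        mul_le_mul_of_nonneg_right hδ2 (by positivity)
      nlinarith
    have h2 : w ^ 2 ≤ 2 * (r ^ k) ^ 2 := le_of_mul_le_mul_left h1 hr
    apply abs_le_of_sq_le_sq _ (by positivity)
    rw [mul_pow, Real.sq_sqrt (by norm_num)]
    exact h2
  induction k with
  | zero =>
    refine ⟨1, 1, by simp [scalarMix], by simp [scalarMix, hη]; ring, by ring, ?_, ?_⟩ <;>
    · simp [Real.one_le_sqrt]
  | succ k ih =>
    obtain ⟨w, U, h1, h2, h3, h4, h5⟩ := ih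
    have h6 : r * (r * w - δ * U) ^ 2 +
        δ * ((r * w - δ * U + r * U) ^ 2 - (r * w - δ * U + r * U) * (r * w - δ * U)) =
        r ^ (2 * (k + 1) + 1) := by
      have : r ^ (2 * (k + 1) + 1) = r ^ 2 * r ^ (2 * k + 1) := by ring
      rw [this, ← h3]; ring
    have h7 := key (k + 1) _ _ h6
    refine ⟨r * w - δ * U, r * w - δ * U + r * U, ?_, ?_, h6, h7, ?_⟩
    · simp only [scalarMix]
      rw [h2, h1, hmul]; ring
    · simp only [scalarMix]
      rw [h1, hη]; ring
    · calc |r * w - δ * U + r * U| ≤ |r * w - δ * U| + |r * U| := abs_add_le _ _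
        _ ≤ √2 * r ^ (k + 1) + r * (√2 * (k + 1) * r ^ k) := by
            rw [abs_mul r U, abs_of_pos hr]; gcongr
        _ = √2 * ((k + 1 : ℕ) + 1) * r ^ (k + 1) := by push_cast; ring

lemma abs_scalarMix_le {η lam r : ℝ} (hr : 0 ≤ r) (hr1 : r ≤ 1) (hη : η = r ^ 2)
    (hlam : 0 ≤ lam) (hlam' : (1 + η) * lam ≤ 2 * r) (k : ℕ) :
    |(scalarMix η lam k).1| ≤ √2 * r ^ k * (1 + k * (1 - r)) := by
  rcases hr.eq_or_lt with rfl | hr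
  · have hη0 : η = 0 := by simpa using hη
    subst hη0
    have hl : lam = 0 := by linarith
    subst hl
    cases k with
    | zero => simp [scalarMix, Real.one_le_sqrt]
    | succ k => simp [scalarMix]
  · obtain ⟨w, U, h1, -, -, h4, h5⟩ := exists_chebyshev_scalarMix hr hη hlam hlam' k
    rw [h1]
    calc |(1 - r) * U + r * w| ≤ (1 - r) * |U| + r * |w| := by
          refine (abs_add_le _ _).trans ?_
          rw [abs_mul, abs_mul, abs_of_pos hr, abs_of_nonneg (sub_nonneg.2 hr1)]
      _ ≤ (1 - r) * (√2 * (k + 1) * r ^ k) + r * (√2 * r ^ k) := by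
          have := sub_nonneg.2 hr1
          gcongr
      _ = _ := by ring

/-- With the momentum tuned to `l` and `σ = √(1 - l)`, the recursion contracts every eigenvalue in
`[0, l]` at the accelerated rate. -/
lemma sq_scalarMix_le {l lam : ℝ} (hl1 : l < 1) (hlam : 0 ≤ lam) (hle : lam ≤ l) (k : ℕ) :
    (scalarMix ((1 - √(1 - l ^ 2)) / (1 + √(1 - l ^ 2))) lam k).1 ^ 2 ≤
      3 * Real.exp (-(k * √(1 - l))) := by
  set s := √(1 - l ^ 2) with hs
  set σ := √(1 - l) with hσ
  have hl0 : 0 ≤ l := hlam.trans hle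
  have hs2 : s ^ 2 = 1 - l ^ 2 := Real.sq_sqrt (by nlinarith)
  have hσ2 : σ ^ 2 = 1 - l := Real.sq_sqrt (by linarith)
  have hs0 : 0 ≤ s := Real.sqrt_nonneg _
  have hσ0 : 0 ≤ σ := Real.sqrt_nonneg _
  have hσs : σ ≤ s := Real.sqrt_le_sqrt (by nlinarith)
  set r := l / (1 + s) with hr
  have hr0 : 0 ≤ r := by positivity
  have hrσ : r ≤ 1 - σ := by
    have hσ1 : σ ≤ 1 := by
      rw [hσ]; exact Real.sqrt_le_one.2 (by linarith)
    rw [hr, div_le_iff₀ (by positivity)]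
    nlinarith [mul_nonneg (sub_nonneg.2 hσ1) (sub_nonneg.2 hσs)]
  have hη : (1 - s) / (1 + s) = r ^ 2 := by
    rw [hr, div_pow, div_eq_div_iff (by positivity) (by positivity)]
    have : l ^ 2 = (1 - s) * (1 + s) := by linarith
    rw [this]; ring
  have hcrit : (1 + (1 - s) / (1 + s)) * lam ≤ 2 * r := by
    have : 1 + (1 - s) / (1 + s) = 2 / (1 + s) := by field_simp; ring
    rw [this, hr, mul_div_assoc', div_mul_eq_mul_div]
    gcongr
  have h := abs_scalarMix_le hr0 (by linarith) hη hlam hcrit k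
  set a := k * (1 - r) with ha
  have ha0 : 0 ≤ a := mul_nonneg (Nat.cast_nonneg _) (by linarith)
  have hak : k * σ ≤ a := mul_le_mul_of_nonneg_left (by linarith) (Nat.cast_nonneg _)
  have hrk : r ^ k ≤ Real.exp (-a) := by
    have : r ≤ Real.exp (-(1 - r)) := by
      have := Real.add_one_le_exp (-(1 - r)); linarith
    calc r ^ k ≤ Real.exp (-(1 - r)) ^ k := pow_le_pow_left₀ hr0 this k
      _ = Real.exp (-a) := by rw [← Real.exp_nat_mul, ha]; ring_nf
  have h1a : 1 + a ≤ 2 * Real.exp ((a - 1) / 2) := by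
    have := Real.add_one_le_exp ((a - 1) / 2); linarith
  have he : 8 * Real.exp (-1) ≤ 3 := by
    have := Real.exp_neg_one_lt_d9; linarith
  calc (scalarMix ((1 - s) / (1 + s)) lam k).1 ^ 2
      = |(scalarMix ((1 - s) / (1 + s)) lam k).1| ^ 2 := (sq_abs _).symm
    _ ≤ (√2 * Real.exp (-a) * (2 * Real.exp ((a - 1) / 2))) ^ 2 := by
        refine pow_le_pow_left₀ (abs_nonneg _) (h.trans ?_) 2
        gcongr
    _ = 8 * Real.exp (-1) * Real.exp (-a) := by
        rw [mul_pow, mul_pow, mul_pow, Real.sq_sqrt (by norm_num), ← Real.exp_nat_mul,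
          ← Real.exp_nat_mul]
        rw [show 2 * Real.exp ((2 : ℕ) * -a) * (2 ^ 2 * Real.exp ((2 : ℕ) * ((a - 1) / 2))) =
          8 * (Real.exp ((2 : ℕ) * -a) * Real.exp ((2 : ℕ) * ((a - 1) / 2))) by ring, mul_assoc,
          ← Real.exp_add, ← Real.exp_add]
        push_cast
        ring_nf
    _ ≤ 3 * Real.exp (-(k * σ)) := by gcongr

/-! ### The gossip matrix and `FastMix` on aggregates -/

/-- The combination `∑ i, w i • u i` of the rows of `u`. -/
def proj {m d : ℕ} (w : Fin m → ℝ) (u : Agg m d) : Vec d := ∑ i, w i • u i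

lemma proj_sub {m d : ℕ} (w : Fin m → ℝ) (u v : Agg m d) :
    proj w (u - v) = proj w u - proj w v := by
  simp [proj, smul_sub]

lemma proj_smul {m d : ℕ} (w : Fin m → ℝ) (c : ℝ) (u : Agg m d) :
    proj w (c • u) = c • proj w u := by
  simp [proj, Finset.smul_sum, smul_comm c]

lemma proj_gossip {m d : ℕ} {W : Matrix (Fin m) (Fin m) ℝ} (hW : W.IsSymm) {w : Fin m → ℝ}
    {lam : ℝ} (hw : W.mulVec w = lam • w) (u : Agg m d) :
    proj w (gossip W u) = lam • proj w u := by
  simp only [proj, gossip, Finset.smul_sum, smul_smul]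
  rw [Finset.sum_comm]
  refine Finset.sum_congr rfl fun j _ => ?_
  rw [← Finset.sum_smul]
  congr 1
  have := congrFun hw j
  simp only [Matrix.mulVec, dotProduct, Pi.smul_apply, smul_eq_mul] at this
  rw [← this]
  refine Finset.sum_congr rfl fun i _ => ?_
  rw [mul_comm, hW.apply]

lemma proj_fastMixPair {m d : ℕ} {W : Matrix (Fin m) (Fin m) ℝ} (hW : W.IsSymm) {w : Fin m → ℝ}
    {lam : ℝ} (hw : W.mulVec w = lam • w) (u : Agg m d) (k : ℕ) :
    proj w (fastMixPair W u k).1 = (scalarMix (etaU W) lam k).1 • proj w u ∧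
      proj w (fastMixPair W u k).2 = (scalarMix (etaU W) lam k).2 • proj w u := by
  induction k with
  | zero => simp [fastMixPair, scalarMix]
  | succ k ih =>
    refine ⟨?_, ih.1⟩
    simp only [fastMixPair, scalarMix]
    rw [proj_sub, proj_smul, proj_smul, proj_gossip hW hw, ih.1, ih.2]
    module

lemma mean_eq_proj {m d : ℕ} (u : Agg m d) :
    mean u = (1 / (m : ℝ)) • proj (fun _ => (1 : ℝ)) u := by
  simp [mean, proj]

lemma mean_fastMix {m d : ℕ} {W : Matrix (Fin m) (Fin m) ℝ} (hW : W.IsSymm)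
    (h1 : W.mulVec (fun _ => (1 : ℝ)) = fun _ => 1) (u : Agg m d) (k : ℕ) :
    mean (fastMix W u k) = mean u := by
  have h : W.mulVec (fun _ => (1 : ℝ)) = (1 : ℝ) • (fun _ => (1 : ℝ)) := by rw [h1, one_smul]
  rw [mean_eq_proj, mean_eq_proj, fastMix, (proj_fastMixPair hW h u k).1, scalarMix_one, one_smul]

/-- Parseval's identity for the columns of an aggregate variable. -/
lemma sum_norm_sq_proj {m d : ℕ} (e : OrthonormalBasis (Fin m) ℝ (EuclideanSpace ℝ (Fin m)))
    (u : Agg m d) : ∑ a, ‖proj (e a) u‖ ^ 2 = ∑ i, ‖u i‖ ^ 2 := by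
  have h : ∀ a c, (proj (e a) u) c = inner ℝ (e a) (WithLp.toLp 2 fun i => u i c) := by
    intro a c
    simp [proj, PiLp.inner_apply, mul_comm]
  simp only [EuclideanSpace.norm_sq_eq, h]
  rw [Finset.sum_comm]
  conv_rhs => rw [Finset.sum_comm]
  refine Finset.sum_congr rfl fun c _ => ?_
  rw [e.sum_sq_norm_inner_right, EuclideanSpace.norm_sq_eq]

lemma lambda2_eq {m : ℕ} {W : Matrix (Fin m) (Fin m) ℝ} (hW : W.IsHermitian)
    (hm : 1 < Fintype.card (Fin m)) : lambda2 W = hW.eigenvalues₀ ⟨1, hm⟩ := by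
  have h := hW.sort_roots_charpoly_eq_eigenvalues₀
  have h' : W.charpoly.roots.sort (· ≥ ·) = List.ofFn hW.eigenvalues₀ := by
    rw [← h]; congr 1; symm; exact Multiset.map_id' _
  rw [lambda2, h', List.getD_eq_getElem?_getD, List.getElem?_ofFn]
  simp only [dif_pos hm, Option.getD_some]

lemma lambda2_nonneg {m : ℕ} (hm : 2 ≤ m) {W : Matrix (Fin m) (Fin m) ℝ} (hW : W.PosSemidef) :
    0 ≤ lambda2 W := by
  have hm' : 1 < Fintype.card (Fin m) := by rw [Fintype.card_fin]; omega
  rw [lambda2_eq hW.1 hm']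
  have := hW.eigenvalues_nonneg ((Fintype.equivOfCardEq (Fintype.card_fin _)) ⟨1, hm'⟩)
  simpa [Matrix.IsHermitian.eigenvalues] using this

lemma min_eigenvalues_le_lambda2 {m : ℕ} (hm : 2 ≤ m) {W : Matrix (Fin m) (Fin m) ℝ}
    (hW : W.IsHermitian) {a a' : Fin m} (h : a ≠ a') :
    min (hW.eigenvalues a) (hW.eigenvalues a') ≤ lambda2 W := by
  have hm' : 1 < Fintype.card (Fin m) := by rw [Fintype.card_fin]; omega
  rw [lambda2_eq hW hm']
  simp only [Matrix.IsHermitian.eigenvalues]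
  set E := (Fintype.equivOfCardEq (α := Fin (Fintype.card (Fin m))) (β := Fin m)
    (Fintype.card_fin _)).symm
  have hne : E a ≠ E a' := E.injective.ne h
  by_cases h1 : (⟨1, hm'⟩ : Fin (Fintype.card (Fin m))) ≤ E a
  · exact (min_le_left _ _).trans (hW.eigenvalues₀_antitone h1)
  · refine (min_le_right _ _).trans (hW.eigenvalues₀_antitone ?_)
    rw [Fin.le_def] at h1 ⊢
    have : (E a : ℕ) ≠ E a' := fun h => hne (Fin.ext h)
    simp only at h1 ⊢
    omega

/-- The deviation `u - 𝟏 ū` of the rows from their mean. -/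
def dev {m d : ℕ} (u : Agg m d) : Agg m d := fun i => u i - mean u

lemma sum_dev {m d : ℕ} (hm : m ≠ 0) (u : Agg m d) : ∑ i, dev u i = 0 := by
  have : (m : ℝ) ≠ 0 := by exact_mod_cast hm
  simp [dev, mean, ← Nat.cast_smul_eq_nsmul ℝ, smul_smul, this]

/-- Any eigenvector of the gossip matrix is either in the span of `𝟏`, on which deviations vanish,
or orthogonal to `𝟏`, with an eigenvalue at most `λ₂`. -/
lemma proj_dev_dichotomy {m d : ℕ} (hm : 2 ≤ m) {W : Matrix (Fin m) (Fin m) ℝ}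
    (hW : W.IsHermitian) (h1 : W.mulVec (fun _ => (1 : ℝ)) = fun _ => 1) (hl : lambda2 W < 1)
    (a : Fin m) :
    (∀ u : Agg m d, proj (hW.eigenvectorBasis a) (dev u) = 0) ∨
      (hW.eigenvalues a ≤ lambda2 W ∧
        ∀ u : Agg m d, proj (hW.eigenvectorBasis a) (dev u) = proj (hW.eigenvectorBasis a) u) := by
  set e := hW.eigenvectorBasis
  set c : Fin m → ℝ := fun a => ∑ i, e a i with hc
  have hsymm : W.IsSymm := by
    have := hW; rwa [Matrix.IsHermitian, Matrix.conjTranspose_eq_transpose_of_trivial] at this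
  have hce : ∀ a, c a = hW.eigenvalues a * c a := by
    intro a
    have h2 : ∑ i, (W.mulVec (e a)) i = hW.eigenvalues a * c a := by
      rw [hW.mulVec_eigenvectorBasis a]; simp [hc, Finset.mul_sum, e]
    rw [← h2]
    simp only [Matrix.mulVec, dotProduct]
    rw [Finset.sum_comm]
    refine Finset.sum_congr rfl fun j _ => ?_
    rw [← Finset.sum_mul]
    have : ∑ i, W i j = 1 := by
      rw [← congrFun h1 j]
      simp only [Matrix.mulVec, dotProduct, mul_one, hsymm.apply]
    rw [this, one_mul]
  have hone : ∀ i, (1 : ℝ) = ∑ b, c b * e b i := by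
    intro i
    have h := e.sum_repr' (WithLp.toLp 2 fun _ => (1 : ℝ))
    have h' := congrArg (fun v : EuclideanSpace ℝ (Fin m) => v i) h
    simp only [PiLp.inner_apply, WithLp.ofLp_sum, Finset.sum_apply, PiLp.smul_apply,
      smul_eq_mul] at h'
    rw [← h']
    refine Finset.sum_congr rfl fun b _ => ?_
    simp [hc]
  by_cases hca : c a = 0
  · right
    refine ⟨?_, fun u => ?_⟩
    · obtain ⟨b, hb⟩ : ∃ b, c b ≠ 0 := by
        by_contra! h
        have := hone ⟨0, by omega⟩
        simp [h] at this
      have hlb : hW.eigenvalues b = 1 := by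
        have := hce b
        field_simp at this
        exact this.symm
      have hab : a ≠ b := by rintro rfl; exact hb hca
      have h := min_eigenvalues_le_lambda2 hm hW hab
      rw [hlb] at h
      rcases min_le_iff.1 h with h | h
      · exact h
      · linarith
    · simp only [proj, dev, smul_sub, Finset.sum_sub_distrib, ← Finset.sum_smul]
      rw [show ∑ i, e a i = 0 from hca]; simp
  · left
    intro u
    have hla : hW.eigenvalues a = 1 := by
      have := hce a
      field_simp at this
      exact this.symm
    have hcb : ∀ b, b ≠ a → c b = 0 := by
      intro b hb
      by_contra hcb
      have hlb : hW.eigenvalues b = 1 := by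
        have := hce b
        field_simp at this
        exact this.symm
      have h := min_eigenvalues_le_lambda2 hm hW hb
      rw [hla, hlb, min_self] at h
      linarith
    have hea : ∀ i, e a i = (c a)⁻¹ := by
      intro i
      have := hone i
      rw [Finset.sum_eq_single a (fun b _ hb => by rw [hcb b hb, zero_mul]) (by simp)] at this
      field_simp
      linarith
    simp only [proj, hea, ← Finset.smul_sum, sum_dev (by omega : m ≠ 0) u, smul_zero]

lemma consensusErrorSq_eq {m d : ℕ} (u : Agg m d) :
    consensusErrorSq u = ∑ i, ‖dev u i‖ ^ 2 := rfl

/-- `FastMix` contracts the consensus error at the accelerated rate `√(1 - λ₂)`. -/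
theorem consensusErrorSq_fastMix_le {m d : ℕ} (hm : 2 ≤ m) {W : Matrix (Fin m) (Fin m) ℝ}
    (hW : W.PosSemidef) (h1 : W.mulVec (fun _ => (1 : ℝ)) = fun _ => 1) (hl : lambda2 W < 1)
    (u : Agg m d) (k : ℕ) :
    consensusErrorSq (fastMix W u k) ≤
      3 * Real.exp (-(k * √(1 - lambda2 W))) * consensusErrorSq u := by
  have hH := hW.1
  have hsymm : W.IsSymm := by
    have := hH; rwa [Matrix.IsHermitian, Matrix.conjTranspose_eq_transpose_of_trivial] at this
  rw [consensusErrorSq_eq, consensusErrorSq_eq, ← sum_norm_sq_proj hH.eigenvectorBasis (dev u),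
    ← sum_norm_sq_proj hH.eigenvectorBasis (dev (fastMix W u k)), Finset.mul_sum]
  refine Finset.sum_le_sum fun a _ => ?_
  rcases proj_dev_dichotomy (d := d) hm hH h1 hl a with h | ⟨hle, h⟩
  · rw [h, h]; simp
  · rw [h, h, fastMix, (proj_fastMixPair hsymm (hH.mulVec_eigenvectorBasis a) u k).1, norm_smul,
      mul_pow, Real.norm_eq_abs, sq_abs]
    exact mul_le_mul_of_nonneg_right
      (sq_scalarMix_le hl (hW.eigenvalues_nonneg a) hle k) (sq_nonneg _)

/-! ### Independent coordinates of a finite product space -/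

section Product

variable {ι α : Type*} [Fintype ι] [DecidableEq ι] [Fintype α]

/-- The expectation of `F` when the coordinates are independent with weights `w` on `α`. -/
def prodExp (w : α → ℝ) (F : (ι → α) → ℝ) : ℝ := ∑ ω, (∏ s, w (ω s)) * F ω

lemma prodExp_mono {w : α → ℝ} (hw : ∀ z, 0 ≤ w z) {F F' : (ι → α) → ℝ} (h : ∀ ω, F ω ≤ F' ω) :
    prodExp w F ≤ prodExp w F' :=
  Finset.sum_le_sum fun ω _ =>
    mul_le_mul_of_nonneg_left (h ω) (Finset.prod_nonneg fun _ _ => hw _)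

lemma prodExp_add (w : α → ℝ) (F F' : (ι → α) → ℝ) :
    prodExp w (fun ω => F ω + F' ω) = prodExp w F + prodExp w F' := by
  simp [prodExp, mul_add, Finset.sum_add_distrib]

lemma prodExp_mul (w : α → ℝ) (c : ℝ) (F : (ι → α) → ℝ) :
    prodExp w (fun ω => c * F ω) = c * prodExp w F := by
  simp only [prodExp, Finset.mul_sum]
  exact Finset.sum_congr rfl fun _ _ => by ring

lemma prodExp_sum {β : Type*} (w : α → ℝ) (S : Finset β) (F : β → (ι → α) → ℝ) :
    prodExp w (fun ω => ∑ b ∈ S, F b ω) = ∑ b ∈ S, prodExp w (F b) := by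
  simp only [prodExp, Finset.mul_sum]
  exact Finset.sum_comm

lemma prodExp_const {w : α → ℝ} (hw : ∑ z, w z = 1) (c : ℝ) :
    prodExp w (fun _ : ι → α => c) = c := by
  rw [prodExp, ← Finset.sum_mul, ← Fintype.piFinset_univ, ← Finset.prod_univ_sum]
  simp [hw]

/-- Resampling one coordinate: it may be integrated out separately, with the rest of the sample
fixed. -/
lemma prodExp_resample {w : α → ℝ} (hw : ∑ z, w z = 1) (t : ι) (G : α → (ι → α) → ℝ)
    (hG : ∀ z ω z', G z (Function.update ω t z') = G z ω) :
    prodExp w (fun ω => G (ω t) ω) = prodExp w (fun ω => ∑ z, w z * G z ω) := by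
  have hprod : ∀ (ω : ι → α) z,
      (∏ s, w (Function.update ω t z s)) * w (ω t) = (∏ s, w (ω s)) * w z := by
    intro ω z
    rw [Fintype.prod_eq_mul_prod_compl t, Fintype.prod_eq_mul_prod_compl t (fun s => w (ω s))]
    rw [Finset.prod_congr rfl (g := fun s => w (ω s)) fun s hs => by
      rw [Function.update_of_ne (by simpa using hs)]]
    rw [Function.update_self]; ring
  -- Exchanging the coordinate `t` of `ω` with an independent copy `z` preserves the weights.
  let swap : (ι → α) × α → (ι → α) × α := fun q => (Function.update q.1 t q.2, q.1 t)
  have hswap : Function.Involutive swap := by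
    rintro ⟨ω, z⟩
    simp [swap]
  have h := Equiv.sum_comp hswap.toPerm
    (fun q : (ι → α) × α => (∏ s, w (q.1 s)) * w q.2 * G (q.1 t) q.1)
  simp only [Function.Involutive.coe_toPerm, swap, hprod, Function.update_self, hG] at h
  rw [Fintype.sum_prod_type, Fintype.sum_prod_type] at h
  simp only [prodExp, Finset.mul_sum]
  simp only [← mul_assoc]
  rw [h]
  refine Finset.sum_congr rfl fun ω _ => ?_
  change _ = ∑ y, (∏ s, w (ω s)) * w y * G (ω t) ω
  rw [← Finset.sum_mul, ← Finset.mul_sum, hw, mul_one]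

end Product

/-- Variance of a sum of independent centred vectors around a fixed vector. -/
lemma prodExp_norm_sq_add_sum {ι α E : Type*} [Fintype ι] [DecidableEq ι] [Fintype α]
    [NormedAddCommGroup E] [InnerProductSpace ℝ E] {w : α → ℝ} (hw : ∑ z, w z = 1)
    (c : E) (Y : ι → α → E) (hY : ∀ a, ∑ z, w z • Y a z = 0) (S : Finset ι) :
    prodExp w (fun ω => ‖c + ∑ a ∈ S, Y a (ω a)‖ ^ 2) =
      ‖c‖ ^ 2 + ∑ a ∈ S, ∑ z, w z * ‖Y a z‖ ^ 2 := by
  induction S using Finset.induction_on with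
  | empty => simp [prodExp_const hw]
  | insert a S ha ih =>
    have h := prodExp_resample hw a
      (fun z ω => ‖c + ∑ b ∈ S, Y b (ω b) + Y a z‖ ^ 2) (by
        intro z ω z'
        rw [Finset.sum_congr rfl fun b hb => by
          rw [Function.update_of_ne (by rintro rfl; exact ha hb)]])
    have h2 : ∀ ω : ι → α, ∑ z, w z * ‖c + ∑ b ∈ S, Y b (ω b) + Y a z‖ ^ 2 =
        ‖c + ∑ b ∈ S, Y b (ω b)‖ ^ 2 + ∑ z, w z * ‖Y a z‖ ^ 2 := by
      intro ω
      set v := c + ∑ b ∈ S, Y b (ω b)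
      have h3 : ∑ z, w z * (2 * inner ℝ v (Y a z)) = 0 := by
        have : ∑ z, w z * (2 * inner ℝ v (Y a z)) = 2 * inner ℝ v (∑ z, w z • Y a z) := by
          rw [inner_sum, Finset.mul_sum]
          refine Finset.sum_congr rfl fun z _ => ?_
          rw [real_inner_smul_right]; ring
        rw [this, hY, inner_zero_right, mul_zero]
      simp only [norm_add_sq_real, mul_add, Finset.sum_add_distrib]
      rw [h3, ← Finset.sum_mul, hw]; ring
    simp only [h2] at h
    rw [Finset.sum_insert ha]
    rw [prodExp_add, ih, prodExp_const hw] at h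
    rw [show (fun ω : ι → α => ‖c + ∑ b ∈ insert a S, Y b (ω b)‖ ^ 2) =
      fun ω => ‖c + ∑ b ∈ S, Y b (ω b) + Y a (ω a)‖ ^ 2 by
        funext ω; rw [Finset.sum_insert ha, add_comm (Y a (ω a)), add_assoc], h]
    ring

/-! ### The noise of one iteration and the law of the run -/

/-- The expectation over the indices `ξ`, independent and uniform on `Fin n`. -/
def indexExp {m n b : ℕ} (F : (Fin m → Fin b → Fin n) → ℝ) : ℝ :=
  ∑ ξ, (∏ _i : Fin m, ∏ _j : Fin b, (1 / (n : ℝ))) * F ξ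

lemma indexExp_eq_prodExp {m n b : ℕ} (F : (Fin m → Fin b → Fin n) → ℝ) :
    indexExp F = prodExp (ι := Fin m × Fin b) (fun _ : Fin n => 1 / (n : ℝ))
      (fun ω => F (fun i j => ω (i, j))) := by
  rw [indexExp, prodExp]
  refine Fintype.sum_equiv (Equiv.curry _ _ _).symm _ _ fun ξ => ?_
  rw [Fintype.prod_prod_type]
  rfl

lemma sum_uniform {n : ℕ} (hn : 1 ≤ n) : ∑ _k : Fin n, 1 / (n : ℝ) = 1 := by
  have : (n : ℝ) ≠ 0 := by positivity
  simp [this]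

lemma indexExp_mono {m n b : ℕ} {F F' : (Fin m → Fin b → Fin n) → ℝ} (h : ∀ ξ, F ξ ≤ F' ξ) :
    indexExp F ≤ indexExp F' :=
  Finset.sum_le_sum fun ξ _ => mul_le_mul_of_nonneg_left (h ξ)
    (Finset.prod_nonneg fun _ _ => Finset.prod_nonneg fun _ _ => by positivity)

lemma indexExp_add {m n b : ℕ} (F F' : (Fin m → Fin b → Fin n) → ℝ) :
    indexExp (fun ξ => F ξ + F' ξ) = indexExp F + indexExp F' := by
  simp [indexExp, mul_add, Finset.sum_add_distrib]

lemma indexExp_mul {m n b : ℕ} (c : ℝ) (F : (Fin m → Fin b → Fin n) → ℝ) :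
    indexExp (fun ξ => c * F ξ) = c * indexExp F := by
  simp only [indexExp, Finset.mul_sum]
  exact Finset.sum_congr rfl fun _ _ => by ring

lemma indexExp_sum {β : Type*} {m n b : ℕ} (S : Finset β)
    (F : β → (Fin m → Fin b → Fin n) → ℝ) :
    indexExp (fun ξ => ∑ i ∈ S, F i ξ) = ∑ i ∈ S, indexExp (F i) := by
  simp only [indexExp, Finset.mul_sum]
  exact Finset.sum_comm

lemma indexExp_const {m n b : ℕ} (hn : 1 ≤ n) (c : ℝ) :
    indexExp (fun _ : Fin m → Fin b → Fin n => c) = c := by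
  rw [indexExp_eq_prodExp]
  exact prodExp_const (sum_uniform hn) c

/-- The probability of the noise `z` of one iteration. -/
def noiseWeight {m n b : ℕ} (p : ℝ) (z : Noise m n b) : ℝ :=
  (if z.1 then p else 1 - p) * ∏ _i : Fin m, ∏ _j : Fin b, (1 / (n : ℝ))

lemma sum_noiseWeight_mul {m n b : ℕ} (p : ℝ) (F : Noise m n b → ℝ) :
    ∑ z, noiseWeight p z * F z =
      p * indexExp (fun ξ => F (true, ξ)) + (1 - p) * indexExp (fun ξ => F (false, ξ)) := by
  simp only [Fintype.sum_prod_type, Fintype.sum_bool, noiseWeight, indexExp, Finset.mul_sum,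
    if_true, Bool.false_eq_true, if_false, mul_assoc]

lemma sum_noiseWeight {m n b : ℕ} (hn : 1 ≤ n) (p : ℝ) :
    ∑ z : Noise m n b, noiseWeight p z = 1 := by
  have := sum_noiseWeight_mul (m := m) (n := n) (b := b) p (fun _ => 1)
  simp only [mul_one, indexExp_const hn] at this
  rw [this]; ring

lemma noiseWeight_nonneg {m n b : ℕ} {p : ℝ} (hp0 : 0 ≤ p) (hp1 : p ≤ 1) (z : Noise m n b) :
    0 ≤ noiseWeight p z := by
  refine mul_nonneg ?_ (Finset.prod_nonneg fun _ _ => Finset.prod_nonneg fun _ _ => by positivity)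
  split_ifs
  · exact hp0
  · linarith

section Run

variable {m n d : ℕ} (f : Fin m → Fin n → Vec d → ℝ) (W : Matrix (Fin m) (Fin m) ℝ)
  (x₀ : Vec d) (P : Params)

/-- The expectation of `F` over the noise of all iterations. -/
def runExp (F : (Fin P.T → Noise m n P.b) → ℝ) : ℝ := prodExp (noiseWeight P.p) F

lemma run_update {t : Fin P.T} {k : ℕ} (hk : k ≤ t) (ω : Fin P.T → Noise m n P.b)
    (z : Noise m n P.b) : run f W x₀ P (Function.update ω t z) k = run f W x₀ P ω k := by
  induction k with
  | zero => rfl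
  | succ k ih =>
    simp only [run]
    rw [ih (by omega)]
    have hne : ∀ h : k < P.T, (⟨k, h⟩ : Fin P.T) ≠ t := by
      rintro h rfl
      simp at hk
    split_ifs with h
    · rw [Function.update_of_ne (hne h)]
    · rfl

/-- The Markov property of the run: given the first `t` iterations, the next state is obtained by
averaging over the noise of iteration `t`. -/
lemma runExp_succ (hn : 1 ≤ n) {t : ℕ} (ht : t < P.T) (F : State m d → ℝ) :
    runExp P (fun ω => F (run f W x₀ P ω (t + 1))) =
      runExp P (fun ω => ∑ z : Noise m n P.b, noiseWeight P.p z *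
        F (step f W P z (run f W x₀ P ω t))) := by
  have h := prodExp_resample (sum_noiseWeight (m := m) (b := P.b) hn P.p) (⟨t, ht⟩ : Fin P.T)
    (fun z ω => F (step f W P z (run f W x₀ P ω t))) (by
      intro z ω z'
      rw [run_update f W x₀ P (t := ⟨t, ht⟩) le_rfl])
  rw [runExp, runExp, ← h]
  simp [run, ht]

/-- The output index `(t, i)` is uniform and independent of the run. -/
lemma expect_eq (X : Sample m n P → ℝ) :
    expect P X = runExp P (fun ω => 1 / ((P.T : ℝ) * m) * ∑ t : Fin P.T, ∑ i, X (ω, (t, i))) := by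
  simp only [expect, runExp, prodExp, prob, Fintype.sum_prod_type, noiseWeight, Finset.mul_sum,
    mul_assoc]

lemma expect_of_run (hm : m ≠ 0) (hT : P.T ≠ 0) (X : (Fin P.T → Noise m n P.b) → ℝ) :
    expect P (fun ω : Sample m n P => X ω.1) = runExp P X := by
  rw [expect_eq]
  congr 1
  funext ω
  have h1 : (m : ℝ) ≠ 0 := by exact_mod_cast hm
  have h2 : (P.T : ℝ) ≠ 0 := by exact_mod_cast hT
  simp
  field_simp

end Run

/-! ### Means and deviations -/

lemma mean_add {m d : ℕ} (u v : Agg m d) : mean (u + v) = mean u + mean v := by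
  simp [mean, Finset.sum_add_distrib]

lemma mean_sub {m d : ℕ} (u v : Agg m d) : mean (u - v) = mean u - mean v := by
  simp [mean, smul_sub]

lemma mean_smul {m d : ℕ} (c : ℝ) (u : Agg m d) : mean (c • u) = c • mean u := by
  simp only [mean, Pi.smul_apply, ← Finset.smul_sum]
  rw [smul_comm]

lemma mean_const {m d : ℕ} (hm : m ≠ 0) (v : Vec d) : mean (fun _ : Fin m => v) = v := by
  have : (m : ℝ) ≠ 0 := by exact_mod_cast hm
  simp [mean, ← Nat.cast_smul_eq_nsmul ℝ, smul_smul, this]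

lemma consensusErrorSq_nonneg {m d : ℕ} (u : Agg m d) : 0 ≤ consensusErrorSq u :=
  Finset.sum_nonneg fun _ _ => sq_nonneg _

lemma sum_norm_sq_eq {m d : ℕ} (hm : m ≠ 0) (u : Agg m d) :
    ∑ i, ‖u i‖ ^ 2 = consensusErrorSq u + m * ‖mean u‖ ^ 2 := by
  have h : ∀ i, ‖u i‖ ^ 2 = ‖dev u i‖ ^ 2 + 2 * inner ℝ (dev u i) (mean u) + ‖mean u‖ ^ 2 := by
    intro i
    rw [← norm_add_sq_real]; simp [dev]
  simp only [h, Finset.sum_add_distrib, ← Finset.mul_sum, ← sum_inner, sum_dev hm]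
  simp [consensusErrorSq_eq]

lemma consensusErrorSq_le {m d : ℕ} (hm : m ≠ 0) (u : Agg m d) :
    consensusErrorSq u ≤ ∑ i, ‖u i‖ ^ 2 := by
  rw [sum_norm_sq_eq hm]
  have : 0 ≤ (m : ℝ) * ‖mean u‖ ^ 2 := by positivity
  linarith

lemma mean_norm_sq_le {m d : ℕ} (hm : m ≠ 0) (u : Agg m d) :
    ‖mean u‖ ^ 2 ≤ 1 / (m : ℝ) * ∑ i, ‖u i‖ ^ 2 := by
  have h : (m : ℝ) ≠ 0 := by exact_mod_cast hm
  rw [sum_norm_sq_eq hm, mul_add, ← mul_assoc, one_div_mul_cancel h, one_mul]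
  have : 0 ≤ 1 / (m : ℝ) * consensusErrorSq u :=
    mul_nonneg (by positivity) (consensusErrorSq_nonneg u)
  linarith

lemma norm_add_sq_le_two {E : Type*} [SeminormedAddCommGroup E] (a b : E) :
    ‖a + b‖ ^ 2 ≤ 2 * ‖a‖ ^ 2 + 2 * ‖b‖ ^ 2 := by
  have h := norm_add_le a b
  have h0 := norm_nonneg (a + b)
  nlinarith [sq_nonneg (‖a‖ - ‖b‖)]

lemma norm_sub_sq_le_two {E : Type*} [SeminormedAddCommGroup E] (a b : E) :
    ‖a - b‖ ^ 2 ≤ 2 * ‖a‖ ^ 2 + 2 * ‖b‖ ^ 2 := by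
  have := norm_add_sq_le_two a (-b)
  rwa [norm_neg, ← sub_eq_add_neg] at this

lemma consensusErrorSq_add_le {m d : ℕ} (u v : Agg m d) :
    consensusErrorSq (u + v) ≤ 2 * consensusErrorSq u + 2 * consensusErrorSq v := by
  simp only [consensusErrorSq, Finset.mul_sum, ← Finset.sum_add_distrib]
  refine Finset.sum_le_sum fun i _ => ?_
  rw [mean_add, Pi.add_apply, add_sub_add_comm]
  exact norm_add_sq_le_two _ _

lemma consensusErrorSq_smul {m d : ℕ} (c : ℝ) (u : Agg m d) :
    consensusErrorSq (c • u) = c ^ 2 * consensusErrorSq u := by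
  simp only [consensusErrorSq, Finset.mul_sum, mean_smul, Pi.smul_apply, ← smul_sub, norm_smul,
    mul_pow, Real.norm_eq_abs, sq_abs]

lemma consensusErrorSq_sub_le {m d : ℕ} (u v : Agg m d) :
    consensusErrorSq (u - v) ≤ 2 * consensusErrorSq u + 2 * consensusErrorSq v := by
  have h := consensusErrorSq_add_le u ((-1 : ℝ) • v)
  rw [consensusErrorSq_smul] at h
  simpa [sub_eq_add_neg] using h

lemma mean_sq_dist_le {m d : ℕ} (hm : m ≠ 0) (u v : Agg m d) :
    1 / (m : ℝ) * ∑ i, ‖u i - v i‖ ^ 2 ≤ ‖mean u - mean v‖ ^ 2 +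
      2 * (consensusErrorSq u / m) + 2 * (consensusErrorSq v / m) := by
  have h : (0 : ℝ) < m := by exact_mod_cast Nat.pos_of_ne_zero hm
  have h1 := sum_norm_sq_eq hm (u - v)
  have h2 := consensusErrorSq_sub_le u v
  rw [mean_sub] at h1
  simp only [Pi.sub_apply] at h1
  rw [h1]
  have e : 1 / (m : ℝ) * (consensusErrorSq (u - v) + m * ‖mean u - mean v‖ ^ 2) =
      consensusErrorSq (u - v) / m + ‖mean u - mean v‖ ^ 2 := by field_simp
  rw [e]
  have : consensusErrorSq (u - v) / m ≤
      (2 * consensusErrorSq u + 2 * consensusErrorSq v) / m := by gcongr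
  have e2 : (2 * consensusErrorSq u + 2 * consensusErrorSq v) / m =
    2 * (consensusErrorSq u / m) + 2 * (consensusErrorSq v / m) := by ring
  linarith

/-! ### Smoothness of the objective -/

section Smooth

variable {m n d : ℕ} {f : Fin m → Fin n → Vec d → ℝ} {L : ℝ}

lemma hasGradientAt_localFn (hf : ∀ i j, Differentiable ℝ (f i j)) (i : Fin m) (x : Vec d) :
    HasGradientAt (localFn f i) (mean fun j => ∇ (f i j) x) x := by
  rw [hasGradientAt_iff_hasFDerivAt, mean, map_smul, map_sum]
  exact (HasFDerivAt.fun_sum fun j _ => ((hf i j) x).hasGradientAt.hasFDerivAt).const_mul _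

lemma gradient_localFn (hf : ∀ i j, Differentiable ℝ (f i j)) (i : Fin m) (x : Vec d) :
    ∇ (localFn f i) x = mean fun j => ∇ (f i j) x :=
  (hasGradientAt_localFn hf i x).gradient

lemma hasGradientAt_globalFn (hf : ∀ i j, Differentiable ℝ (f i j)) (x : Vec d) :
    HasGradientAt (globalFn f) (mean (aggGrad f fun _ => x)) x := by
  rw [hasGradientAt_iff_hasFDerivAt, mean, map_smul, map_sum]
  refine (HasFDerivAt.fun_sum fun i _ => ?_).const_mul _
  rw [aggGrad, gradient_localFn hf]
  exact (hasGradientAt_localFn hf i x).hasFDerivAt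

lemma gradient_globalFn (hf : ∀ i j, Differentiable ℝ (f i j)) (x : Vec d) :
    ∇ (globalFn f) x = mean (aggGrad f fun _ => x) :=
  (hasGradientAt_globalFn hf x).gradient

lemma localFn_smooth (hn : 1 ≤ n) (hf : ∀ i j, Differentiable ℝ (f i j)) (hL : AverageSmooth f L)
    (i : Fin m) (x x' : Vec d) :
    ‖∇ (localFn f i) x - ∇ (localFn f i) x'‖ ^ 2 ≤ L ^ 2 * ‖x - x'‖ ^ 2 := by
  rw [gradient_localFn hf, gradient_localFn hf, ← mean_sub]
  exact (mean_norm_sq_le (by omega) _).trans (hL i x x')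

lemma mean_aggGrad_sub_le (hm : m ≠ 0) (hn : 1 ≤ n) (hf : ∀ i j, Differentiable ℝ (f i j))
    (hL : AverageSmooth f L) (x x' : Agg m d) :
    ‖mean (aggGrad f x) - mean (aggGrad f x')‖ ^ 2 ≤
      L ^ 2 * (1 / (m : ℝ) * ∑ i, ‖x i - x' i‖ ^ 2) := by
  rw [← mean_sub]
  refine (mean_norm_sq_le hm _).trans ?_
  rw [mul_left_comm]
  refine mul_le_mul_of_nonneg_left ?_ (by positivity)
  rw [Finset.mul_sum]
  exact Finset.sum_le_sum fun i _ => localFn_smooth hn hf hL i _ _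

lemma globalFn_smooth (hm : m ≠ 0) (hn : 1 ≤ n) (hL0 : 0 < L)
    (hf : ∀ i j, Differentiable ℝ (f i j)) (hL : AverageSmooth f L) (x x' : Vec d) :
    ‖∇ (globalFn f) x - ∇ (globalFn f) x'‖ ≤ L * ‖x - x'‖ := by
  have h := mean_aggGrad_sub_le hm hn hf hL (fun _ => x) (fun _ => x')
  rw [← gradient_globalFn hf, ← gradient_globalFn hf] at h
  have hm' : (m : ℝ) ≠ 0 := by exact_mod_cast hm
  have e : 1 / (m : ℝ) * ∑ _i : Fin m, ‖x - x'‖ ^ 2 = ‖x - x'‖ ^ 2 := by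
    simp [hm']
  rw [e, ← mul_pow] at h
  exact le_of_sq_le_sq h (by positivity)

/-- The quadratic upper bound for a function with Lipschitz gradient. -/
lemma descent_lemma {E : Type*} [NormedAddCommGroup E] [InnerProductSpace ℝ E] [CompleteSpace E]
    {F : E → ℝ} (hF : Differentiable ℝ F) (h : ∀ x x', ‖∇ F x - ∇ F x'‖ ≤ L * ‖x - x'‖) (x v : E) :
    F (x + v) ≤ F x + inner ℝ (∇ F x) v + L / 2 * ‖v‖ ^ 2 := by
  let φ : ℝ → ℝ := fun t => F (x + t • v) - t * inner ℝ (∇ F x) v - L / 2 * ‖v‖ ^ 2 * t ^ 2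
  have hd : ∀ t, HasDerivAt φ
      (inner ℝ (∇ F (x + t • v)) v - inner ℝ (∇ F x) v - L / 2 * ‖v‖ ^ 2 * (2 * t)) t := by
    intro t
    have h1 : HasDerivAt (fun t : ℝ => x + t • v) v t := by
      simpa using ((hasDerivAt_id t).smul_const v).const_add x
    have h2 := (hF (x + t • v)).hasGradientAt.hasFDerivAt.comp_hasDerivAt t h1
    have h3 := ((hasDerivAt_id t).mul_const (inner ℝ (∇ F x) v))
    have h4 := ((hasDerivAt_pow 2 t).const_mul (L / 2 * ‖v‖ ^ 2))
    refine ((h2.sub h3).sub h4).congr_deriv ?_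
    simp [inner_gradient_left]
  have hanti : AntitoneOn φ (Set.Icc 0 1) := by
    refine antitoneOn_of_deriv_nonpos (convex_Icc 0 1)
      (fun t _ => (hd t).continuousAt.continuousWithinAt)
      (fun t _ => (hd t).differentiableAt.differentiableWithinAt) fun t ht => ?_
    rw [interior_Icc] at ht
    rw [(hd t).deriv, ← inner_sub_left]
    have h1 := real_inner_le_norm (∇ F (x + t • v) - ∇ F x) v
    have h2 := h (x + t • v) x
    rw [add_sub_cancel_left, norm_smul, Real.norm_eq_abs, abs_of_pos ht.1] at h2
    have h3 := mul_le_mul_of_nonneg_right h2 (norm_nonneg v)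
    nlinarith
  have h1 := hanti (Set.left_mem_Icc.2 zero_le_one) (Set.right_mem_Icc.2 zero_le_one) zero_le_one
  simp only [φ, one_smul, zero_smul, add_zero] at h1
  linarith

/-- One gradient step of size `1 / (2 L)` along an inexact gradient `s`. -/
lemma inexact_descent {E : Type*} [NormedAddCommGroup E] [InnerProductSpace ℝ E] [CompleteSpace E]
    {F : E → ℝ} (hL0 : 0 < L) (hF : Differentiable ℝ F)
    (h : ∀ x x', ‖∇ F x - ∇ F x'‖ ≤ L * ‖x - x'‖) (x s : E) :
    F (x - (1 / (2 * L)) • s) ≤ F x - ‖∇ F x‖ ^ 2 / (4 * L) -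
      L / 2 * ‖(1 / (2 * L)) • s‖ ^ 2 + ‖s - ∇ F x‖ ^ 2 / (4 * L) := by
  have h1 := descent_lemma hF h x (-((1 / (2 * L)) • s))
  rw [← sub_eq_add_neg, inner_neg_right, real_inner_smul_right, norm_neg] at h1
  have h2 := norm_sub_sq_real s (∇ F x)
  rw [real_inner_comm] at h2
  have h3 : ‖(1 / (2 * L)) • s‖ ^ 2 = ‖s‖ ^ 2 / (4 * L ^ 2) := by
    rw [norm_smul, mul_pow, Real.norm_eq_abs, sq_abs]; field_simp; ring
  rw [h3] at h1 ⊢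
  rw [h2]
  refine h1.trans (le_of_eq ?_)
  field_simp
  ring

end Smooth

/-! ### The variance of mini-batches -/

section Batch

variable {m n b d : ℕ}

lemma mean_centered (hn : 1 ≤ n) (h : Agg n d) :
    ∑ k, (1 / (n : ℝ)) • (h k - mean h) = 0 := by
  rw [← Finset.smul_sum]
  have := sum_dev (by omega : n ≠ 0) h
  simp only [dev] at this
  rw [this, smul_zero]

/-- The average of `h` over the mini-batch `ξ`. -/
def batch (h : Agg n d) (ξ : Fin b → Fin n) : Vec d := (1 / (b : ℝ)) • ∑ j, h (ξ j)

lemma batch_sub_mean (hb : 1 ≤ b) (h : Agg n d) (ξ : Fin b → Fin n) :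
    batch h ξ - mean h = ∑ j, (1 / (b : ℝ)) • (h (ξ j) - mean h) := by
  have hb' : (b : ℝ) ≠ 0 := by positivity
  rw [← Finset.smul_sum, Finset.sum_sub_distrib, smul_sub, batch]
  simp [← Nat.cast_smul_eq_nsmul ℝ, smul_smul, hb']

lemma indexExp_norm_sq_batch (hn : 1 ≤ n) (hb : 1 ≤ b) (h : Agg n d) (i : Fin m) (c : Vec d) :
    indexExp (fun ξ : Fin m → Fin b → Fin n => ‖c + (batch h (ξ i) - mean h)‖ ^ 2) =
      ‖c‖ ^ 2 + 1 / (b : ℝ) * (consensusErrorSq h / n) := by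
  have hb' : (b : ℝ) ≠ 0 := by positivity
  have key := prodExp_norm_sq_add_sum (ι := Fin m × Fin b) (sum_uniform hn) c
    (fun _ k => (1 / (b : ℝ)) • (h k - mean h))
    (fun _ => by simp only [smul_comm _ (1 / (b : ℝ))]; rw [← Finset.smul_sum, mean_centered hn,
      smul_zero])
    (({i} : Finset (Fin m)) ×ˢ Finset.univ)
  simp only [Finset.sum_product, Finset.sum_singleton] at key
  rw [indexExp_eq_prodExp]
  simp only [batch_sub_mean hb]
  rw [key]
  congr 1
  simp only [norm_smul, mul_pow, Real.norm_eq_abs, sq_abs, ← Finset.mul_sum, Finset.sum_const,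
    Finset.card_univ, Fintype.card_fin, nsmul_eq_mul]
  rw [consensusErrorSq]
  field_simp

lemma indexExp_norm_sq_mean_batch (hn : 1 ≤ n) (hb : 1 ≤ b) (h : Fin m → Agg n d) (c : Vec d) :
    indexExp (fun ξ : Fin m → Fin b → Fin n =>
        ‖c + mean (fun i => batch (h i) (ξ i) - mean (h i))‖ ^ 2) =
      ‖c‖ ^ 2 + 1 / ((m : ℝ) * b) * (1 / (m : ℝ) * ∑ i, consensusErrorSq (h i) / n) := by
  have hb' : (b : ℝ) ≠ 0 := by positivity
  have key := prodExp_norm_sq_add_sum (ι := Fin m × Fin b) (sum_uniform hn) c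
    (fun a k => (1 / (m : ℝ) * (1 / (b : ℝ))) • (h a.1 k - mean (h a.1)))
    (fun a => by simp only [smul_comm _ (1 / (m : ℝ) * (1 / (b : ℝ)))]
                 rw [← Finset.smul_sum, mean_centered hn, smul_zero])
    Finset.univ
  simp only [Fintype.sum_prod_type] at key
  rw [indexExp_eq_prodExp]
  have hmean : ∀ ω : Fin m × Fin b → Fin n,
      mean (fun i => batch (h i) (fun j => ω (i, j)) - mean (h i)) =
        ∑ i, ∑ j, (1 / (m : ℝ) * (1 / (b : ℝ))) • (h i (ω (i, j)) - mean (h i)) := by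
    intro ω
    simp only [batch_sub_mean hb]
    simp only [mean.eq_1 (fun i => ∑ j, _), Finset.smul_sum, smul_smul]
  simp only [hmean]
  rw [key]
  congr 1
  simp only [norm_smul, mul_pow, Real.norm_eq_abs, sq_abs, Finset.sum_const,
    Finset.card_univ, Fintype.card_fin, nsmul_eq_mul, Finset.mul_sum]
  refine Finset.sum_congr rfl fun i _ => ?_
  rw [consensusErrorSq, Finset.sum_div, Finset.mul_sum, Finset.mul_sum]
  refine Finset.sum_congr rfl fun k _ => ?_
  field_simp

/-- Jensen's inequality: a mini-batch average has at most the second moment of a single sample. -/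
lemma indexExp_norm_sq_batch_le (hn : 1 ≤ n) (hb : 1 ≤ b) (h : Agg n d) (i : Fin m) :
    indexExp (fun ξ : Fin m → Fin b → Fin n => ‖batch h (ξ i)‖ ^ 2) ≤
      1 / (n : ℝ) * ∑ k, ‖h k‖ ^ 2 := by
  have key := indexExp_norm_sq_batch hn hb h i (mean h)
  simp only [add_sub_cancel] at key
  have hn' : (n : ℝ) ≠ 0 := by positivity
  have hb' : 1 / (b : ℝ) ≤ 1 := by
    rw [div_le_one (by positivity)]; exact_mod_cast hb
  rw [key, sum_norm_sq_eq (by omega)]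
  have := mul_le_mul_of_nonneg_right hb'
    (div_nonneg (consensusErrorSq_nonneg h) (Nat.cast_nonneg n))
  have e : 1 / (n : ℝ) * (consensusErrorSq h + n * ‖mean h‖ ^ 2) =
    consensusErrorSq h / n + ‖mean h‖ ^ 2 := by field_simp
  linarith

end Batch

/-! ### The Lyapunov function and one iteration -/

/-- The standing assumptions, with the consequences of the choice of parameters that the analysis
of one iteration uses. -/
structure Setting {m n d : ℕ} (f : Fin m → Fin n → Vec d → ℝ) (W : Matrix (Fin m) (Fin m) ℝ)
    (L : ℝ) (P : Params) : Prop where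
  two_le_m : 2 ≤ m
  one_le_n : 1 ≤ n
  L_pos : 0 < L
  posSemidef : W.PosSemidef
  mulVec_one : W.mulVec (fun _ => (1 : ℝ)) = fun _ => 1
  lambda2_lt : lambda2 W < 1
  differentiable : ∀ i j, Differentiable ℝ (f i j)
  smooth : AverageSmooth f L
  η_eq : P.η = 1 / (2 * L)
  one_le_b : 1 ≤ P.b
  le_b : 36 * (n : ℝ) ≤ (P.b : ℝ) ^ 2 * m
  p_eq : P.p = (P.b : ℝ) / ((P.b : ℝ) + (n : ℝ))
  le_K : 6 ≤ P.K * √(1 - lambda2 W)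
  le_Khat : 6 ≤ P.Khat * √(1 - lambda2 W)

section Step

variable {m n d : ℕ} {f : Fin m → Fin n → Vec d → ℝ} {W : Matrix (Fin m) (Fin m) ℝ}
  {L : ℝ} {P : Params}

namespace Setting

variable (A : Setting f W L P)
include A

lemma m_ne_zero : m ≠ 0 := by have := A.two_le_m; omega

lemma m_pos : (0 : ℝ) < m := by exact_mod_cast Nat.pos_of_ne_zero A.m_ne_zero

lemma n_pos : (0 : ℝ) < n := by exact_mod_cast A.one_le_n

lemma b_pos : (0 : ℝ) < P.b := by exact_mod_cast A.one_le_b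

lemma p_pos : 0 < P.p := by
  have := A.b_pos; have := A.n_pos
  rw [A.p_eq]; positivity

lemma p_le_one : P.p ≤ 1 := by
  have := A.b_pos; have := A.n_pos
  rw [A.p_eq, div_le_one (by positivity)]; linarith

lemma isSymm : W.IsSymm := by
  have := A.posSemidef.1
  rwa [Matrix.IsHermitian, Matrix.conjTranspose_eq_transpose_of_trivial] at this

lemma contraction {k : ℕ} (hk : 6 ≤ k * √(1 - lambda2 W)) (u : Agg m d) :
    consensusErrorSq (fastMix W u k) ≤ 1 / 100 * consensusErrorSq u := by
  refine (consensusErrorSq_fastMix_le A.two_le_m A.posSemidef A.mulVec_one A.lambda2_lt u k).trans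
    (mul_le_mul_of_nonneg_right ?_ (consensusErrorSq_nonneg u))
  have h1 : Real.exp (-(k * √(1 - lambda2 W))) ≤ Real.exp (-6) :=
    Real.exp_le_exp.2 (by linarith)
  have h2 : Real.exp (-6) ≤ 1 / 300 := by
    have h3 : Real.exp (-6) = Real.exp (-1) ^ 6 := by
      rw [← Real.exp_nat_mul]; norm_num
    have h4 : Real.exp (-1) ≤ 0.37 := by
      have := Real.exp_neg_one_lt_d9; linarith
    rw [h3]
    calc Real.exp (-1) ^ 6 ≤ 0.37 ^ 6 := pow_le_pow_left₀ (Real.exp_pos _).le h4 6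
      _ ≤ 1 / 300 := by norm_num
  linarith

lemma mean_fastMix (u : Agg m d) (k : ℕ) : mean (fastMix W u k) = mean u :=
  Dearest.mean_fastMix A.isSymm A.mulVec_one u k

lemma differentiable_globalFn : Differentiable ℝ (globalFn f) := fun x =>
  (hasGradientAt_globalFn A.differentiable x).differentiableAt

lemma gradient_lipschitz (x x' : Vec d) :
    ‖∇ (globalFn f) x - ∇ (globalFn f) x'‖ ≤ L * ‖x - x'‖ :=
  globalFn_smooth A.m_ne_zero A.one_le_n A.L_pos A.differentiable A.smooth x x'

end Setting

/-- Consensus error of the iterates, per agent. -/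
def xErr (S : State m d) : ℝ := consensusErrorSq S.x / m

/-- Consensus error of the gradient trackers, per agent. -/
def sErr (S : State m d) : ℝ := consensusErrorSq S.s / m

variable (f) in
/-- Squared error of the local gradient estimators, per agent. -/
def localGradErr (S : State m d) : ℝ :=
  1 / (m : ℝ) * ∑ i, ‖S.g i - ∇ (localFn f i) (S.x i)‖ ^ 2

variable (f) in
/-- Squared error of the mean of the gradient estimators. -/
def meanGradErr (S : State m d) : ℝ := ‖mean S.g - mean (aggGrad f S.x)‖ ^ 2

variable (f) in
/-- The Lyapunov function: the objective at the mean iterate plus weighted error terms. The weight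
of each error pays for what it contributes to the others in the next iteration. -/
def lyapunov (L p : ℝ) (S : State m d) : ℝ :=
  globalFn f (mean S.x) + meanGradErr f S / (2 * L * p) + localGradErr f S / (2000 * L) +
    sErr S / (80 * L) + L * xErr S

lemma xErr_nonneg (S : State m d) : 0 ≤ xErr S :=
  div_nonneg (consensusErrorSq_nonneg _) (Nat.cast_nonneg _)

lemma sErr_nonneg (S : State m d) : 0 ≤ sErr S :=
  div_nonneg (consensusErrorSq_nonneg _) (Nat.cast_nonneg _)

lemma localGradErr_nonneg (S : State m d) : 0 ≤ localGradErr f S :=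
  mul_nonneg (by positivity) (Finset.sum_nonneg fun _ _ => sq_nonneg _)

lemma meanGradErr_nonneg (S : State m d) : 0 ≤ meanGradErr f S := sq_nonneg _

variable (W P) in
/-- The next iterate `x_{t+1}` when `FastMix` runs for `k` rounds. -/
def nextX (S : State m d) (k : ℕ) : Agg m d := fastMix W (S.x - P.η • S.s) k

/-- The mean squared displacement of the agents in one iteration. -/
def moveSq (S : State m d) (x' : Agg m d) : ℝ := 1 / (m : ℝ) * ∑ i, ‖x' i - S.x i‖ ^ 2

variable (f) in
/-- The gradient differences of the individual functions of agent `i` in one iteration. -/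
def gradDiff (S : State m d) (x' : Agg m d) (i : Fin m) : Agg n d :=
  fun k => ∇ (f i k) (x' i) - ∇ (f i k) (S.x i)

lemma step_true (ξ : Fin m → Fin P.b → Fin n) (S : State m d) :
    (step f W P (true, ξ) S).x = nextX W P S P.K ∧
    (step f W P (true, ξ) S).g = aggGrad f (nextX W P S P.K) ∧
    (step f W P (true, ξ) S).s = fastMix W (S.s + (aggGrad f (nextX W P S P.K) - S.g)) P.K := by
  refine ⟨by simp [step, nextX], ?_, ?_⟩
  · funext i; simp [step, nextX, aggGrad]
  · simp only [step, nextX, if_true, add_sub_assoc]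
    rfl

lemma step_false (ξ : Fin m → Fin P.b → Fin n) (S : State m d) :
    (step f W P (false, ξ) S).x = nextX W P S P.Khat ∧
    (step f W P (false, ξ) S).g =
      S.g + (fun i => batch (gradDiff f S (nextX W P S P.Khat) i) (ξ i)) ∧
    (step f W P (false, ξ) S).s =
      fastMix W (S.s + fun i => batch (gradDiff f S (nextX W P S P.Khat) i) (ξ i)) P.Khat := by
  refine ⟨by simp [step, nextX], ?_, ?_⟩
  · funext i; simp [step, nextX, batch, gradDiff]
  · simp only [step, Bool.false_eq_true, if_false, nextX, batch, gradDiff]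
    congr 1
    funext i
    simp [add_sub_assoc]

variable (A : Setting f W L P)
include A

lemma mean_s_step (z : Noise m n P.b) {S : State m d} (h : mean S.s = mean S.g) :
    mean (step f W P z S).s = mean (step f W P z S).g := by
  simp only [step]
  rw [A.mean_fastMix, mean_sub, mean_add, h, add_sub_cancel_left]

lemma mean_nextX (S : State m d) (k : ℕ) :
    mean (nextX W P S k) = mean S.x - P.η • mean S.s := by
  rw [nextX, A.mean_fastMix, mean_sub, mean_smul]

lemma consensusErrorSq_nextX_le (S : State m d) {k : ℕ} (hk : 6 ≤ k * √(1 - lambda2 W)) :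
    consensusErrorSq (nextX W P S k) / m ≤ 1 / 50 * (xErr S + sErr S / (4 * L ^ 2)) := by
  have hm := A.m_pos
  have h1 := (A.contraction hk (S.x - P.η • S.s)).trans
    (mul_le_mul_of_nonneg_left (consensusErrorSq_sub_le _ _) (by norm_num))
  rw [consensusErrorSq_smul] at h1
  have h2 := div_le_div_of_nonneg_right h1 hm.le
  refine h2.trans (le_of_eq ?_)
  have := A.L_pos
  rw [xErr, sErr, A.η_eq]
  field_simp
  ring

lemma moveSq_nextX_le (S : State m d) {k : ℕ} (hk : 6 ≤ k * √(1 - lambda2 W)) :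
    moveSq S (nextX W P S k) ≤ ‖P.η • mean S.s‖ ^ 2 + 2 * xErr S +
      2 * (1 / 50 * (xErr S + sErr S / (4 * L ^ 2))) := by
  have h1 := mean_sq_dist_le A.m_ne_zero (nextX W P S k) S.x
  rw [mean_nextX A, sub_sub_cancel_left, norm_neg] at h1
  have h2 := consensusErrorSq_nextX_le A S hk
  rw [moveSq]
  have : consensusErrorSq S.x / m = xErr S := rfl
  linarith

/-- One step of gradient tracking contracts its consensus error, up to the change of the gradient
estimators. -/
lemma tracking_le (S : State m d) (v : Agg m d) {k : ℕ} (hk : 6 ≤ k * √(1 - lambda2 W)) :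
    consensusErrorSq (fastMix W (S.s + v) k) / m ≤
      1 / 50 * (sErr S + 1 / (m : ℝ) * ∑ i, ‖v i‖ ^ 2) := by
  have hm := A.m_pos
  have h1 := (A.contraction hk (S.s + v)).trans
    (mul_le_mul_of_nonneg_left (consensusErrorSq_add_le _ _) (by norm_num))
  have h2 := consensusErrorSq_le A.m_ne_zero v
  have h3 : consensusErrorSq (fastMix W (S.s + v) k) ≤
      1 / 50 * (consensusErrorSq S.s + ∑ i, ‖v i‖ ^ 2) := by linarith
  refine (div_le_div_of_nonneg_right h3 hm.le).trans (le_of_eq ?_)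
  rw [sErr]; ring

lemma sum_norm_sq_gradDiff_le (S : State m d) (x' : Agg m d) (i : Fin m) :
    1 / (n : ℝ) * ∑ k, ‖gradDiff f S x' i k‖ ^ 2 ≤ L ^ 2 * ‖x' i - S.x i‖ ^ 2 :=
  A.smooth i (x' i) (S.x i)

lemma variance_gradDiff_le (S : State m d) (x' : Agg m d) (i : Fin m) :
    consensusErrorSq (gradDiff f S x' i) / n ≤ L ^ 2 * ‖x' i - S.x i‖ ^ 2 := by
  have hn := A.one_le_n
  refine le_trans ?_ (sum_norm_sq_gradDiff_le A S x' i)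
  rw [div_eq_inv_mul, one_div]
  exact mul_le_mul_of_nonneg_left (consensusErrorSq_le (by omega) _) (by positivity)

lemma mean_gradDiff (S : State m d) (x' : Agg m d) (i : Fin m) :
    mean (gradDiff f S x' i) = ∇ (localFn f i) (x' i) - ∇ (localFn f i) (S.x i) := by
  rw [gradient_localFn A.differentiable, gradient_localFn A.differentiable, ← mean_sub]
  rfl

lemma indexExp_meanGradErr_le (S : State m d) :
    indexExp (fun ξ => meanGradErr f (step f W P (false, ξ) S)) ≤
      meanGradErr f S + L ^ 2 / (m * P.b) * moveSq S (nextX W P S P.Khat) := by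
  set x' := nextX W P S P.Khat with hx'
  have hm := A.m_pos
  have hb := A.b_pos
  have h1 : ∀ ξ, meanGradErr f (step f W P (false, ξ) S) =
      ‖(mean S.g - mean (aggGrad f S.x)) +
        mean (fun i => batch (gradDiff f S x' i) (ξ i) - mean (gradDiff f S x' i))‖ ^ 2 := by
    intro ξ
    rw [meanGradErr, (step_false ξ S).1, (step_false ξ S).2.1, ← mean_sub, ← mean_sub, ← mean_add]
    congr 3
    funext i
    simp only [Pi.sub_apply, Pi.add_apply, aggGrad, mean_gradDiff A, ← hx']
    abel
  simp only [h1]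
  rw [indexExp_norm_sq_mean_batch A.one_le_n A.one_le_b]
  have h2 : ∑ i, consensusErrorSq (gradDiff f S x' i) / n ≤ ∑ i, L ^ 2 * ‖x' i - S.x i‖ ^ 2 :=
    Finset.sum_le_sum fun i _ => variance_gradDiff_le A S x' i
  rw [← Finset.mul_sum] at h2
  have h3 := mul_le_mul_of_nonneg_left h2
    (show (0 : ℝ) ≤ 1 / ((m : ℝ) * P.b) * (1 / (m : ℝ)) by positivity)
  have e : 1 / ((m : ℝ) * P.b) * (1 / (m : ℝ)) * (L ^ 2 * ∑ i, ‖x' i - S.x i‖ ^ 2) =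
      L ^ 2 / (m * P.b) * moveSq S x' := by
    rw [moveSq]; field_simp
  rw [e] at h3
  rw [meanGradErr]
  linarith

lemma indexExp_localGradErr_le (S : State m d) :
    indexExp (fun ξ => localGradErr f (step f W P (false, ξ) S)) ≤
      localGradErr f S + L ^ 2 / P.b * moveSq S (nextX W P S P.Khat) := by
  set x' := nextX W P S P.Khat with hx'
  have hm := A.m_pos
  have hb := A.b_pos
  have h1 : ∀ ξ, localGradErr f (step f W P (false, ξ) S) = 1 / (m : ℝ) * ∑ i,
      ‖(S.g i - ∇ (localFn f i) (S.x i)) +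
        (batch (gradDiff f S x' i) (ξ i) - mean (gradDiff f S x' i))‖ ^ 2 := by
    intro ξ
    rw [localGradErr, (step_false ξ S).1, (step_false ξ S).2.1]
    congr 1
    refine Finset.sum_congr rfl fun i _ => ?_
    congr 2
    simp only [Pi.add_apply, mean_gradDiff A, ← hx']
    abel
  simp only [h1]
  rw [indexExp_mul, indexExp_sum]
  simp only [indexExp_norm_sq_batch A.one_le_n A.one_le_b]
  rw [Finset.sum_add_distrib, ← Finset.mul_sum, mul_add]
  have h2 : ∑ i, consensusErrorSq (gradDiff f S x' i) / n ≤ ∑ i, L ^ 2 * ‖x' i - S.x i‖ ^ 2 :=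
    Finset.sum_le_sum fun i _ => variance_gradDiff_le A S x' i
  rw [← Finset.mul_sum] at h2
  have h3 := mul_le_mul_of_nonneg_left h2
    (show (0 : ℝ) ≤ 1 / (m : ℝ) * (1 / (P.b : ℝ)) by positivity)
  have e : 1 / (m : ℝ) * (1 / (P.b : ℝ)) * (L ^ 2 * ∑ i, ‖x' i - S.x i‖ ^ 2) =
      L ^ 2 / P.b * moveSq S x' := by
    rw [moveSq]; field_simp
  rw [e] at h3
  rw [localGradErr]
  linarith

lemma indexExp_sErr_le (S : State m d) :
    indexExp (fun ξ => sErr (step f W P (false, ξ) S)) ≤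
      1 / 50 * (sErr S + L ^ 2 * moveSq S (nextX W P S P.Khat)) := by
  set x' := nextX W P S P.Khat with hx'
  have hm := A.m_pos
  have h1 : ∀ ξ, sErr (step f W P (false, ξ) S) ≤ 1 / 50 * (sErr S +
      1 / (m : ℝ) * ∑ i, ‖batch (gradDiff f S x' i) (ξ i)‖ ^ 2) := by
    intro ξ
    rw [sErr, (step_false ξ S).2.2, ← hx']
    exact tracking_le A S _ A.le_Khat
  refine (indexExp_mono h1).trans ?_
  rw [indexExp_mul, indexExp_add, indexExp_const A.one_le_n, indexExp_mul, indexExp_sum]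
  have h2 : ∑ i, indexExp (fun ξ => ‖batch (gradDiff f S x' i) (ξ i)‖ ^ 2) ≤
      ∑ i, L ^ 2 * ‖x' i - S.x i‖ ^ 2 := Finset.sum_le_sum fun i _ =>
    (indexExp_norm_sq_batch_le A.one_le_n A.one_le_b (gradDiff f S x' i) i).trans
      (sum_norm_sq_gradDiff_le A S x' i)
  rw [← Finset.mul_sum] at h2
  have h3 := mul_le_mul_of_nonneg_left h2 (show (0 : ℝ) ≤ 1 / (m : ℝ) by positivity)
  rw [moveSq]
  linarith

lemma sErr_step_true_le (ξ : Fin m → Fin P.b → Fin n) (S : State m d) :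
    sErr (step f W P (true, ξ) S) ≤ 1 / 50 * (sErr S +
      (2 * (L ^ 2 * moveSq S (nextX W P S P.K)) + 2 * localGradErr f S)) := by
  set x' := nextX W P S P.K with hx'
  have hm := A.m_pos
  rw [sErr, (step_true ξ S).2.2, ← hx']
  refine (tracking_le A S _ A.le_K).trans ?_
  have h : ∀ i, ‖(aggGrad f x' - S.g) i‖ ^ 2 ≤ 2 * (L ^ 2 * ‖x' i - S.x i‖ ^ 2) +
      2 * ‖S.g i - ∇ (localFn f i) (S.x i)‖ ^ 2 := by
    intro i
    have h1 := norm_sub_sq_le_two (∇ (localFn f i) (x' i) - ∇ (localFn f i) (S.x i))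
      (S.g i - ∇ (localFn f i) (S.x i))
    rw [sub_sub_sub_cancel_right] at h1
    have h2 := localFn_smooth A.one_le_n A.differentiable A.smooth i (x' i) (S.x i)
    simp only [Pi.sub_apply, aggGrad]
    linarith
  have h2 := mul_le_mul_of_nonneg_left (Finset.sum_le_sum fun i (_ : i ∈ Finset.univ) => h i)
    (show (0 : ℝ) ≤ 1 / (m : ℝ) by positivity)
  rw [Finset.sum_add_distrib, ← Finset.mul_sum, ← Finset.mul_sum, ← Finset.mul_sum] at h2
  rw [moveSq, localGradErr]
  linarith

lemma descent_nextX (S : State m d) (hs : mean S.s = mean S.g) (k : ℕ) :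
    globalFn f (mean (nextX W P S k)) ≤ globalFn f (mean S.x) -
      ‖∇ (globalFn f) (mean S.x)‖ ^ 2 / (4 * L) - L / 2 * ‖P.η • mean S.s‖ ^ 2 +
      meanGradErr f S / (2 * L) + L * xErr S / 2 := by
  have hL := A.L_pos
  have hm := A.m_pos
  have h1 := inexact_descent hL A.differentiable_globalFn A.gradient_lipschitz
    (mean S.x) (mean S.s)
  rw [← A.η_eq, ← mean_nextX A S k] at h1
  have h2 : ‖mean S.s - ∇ (globalFn f) (mean S.x)‖ ^ 2 ≤
      2 * meanGradErr f S + 2 * (L ^ 2 * xErr S) := by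
    have h3 := norm_add_sq_le_two (mean S.g - mean (aggGrad f S.x))
      (mean (aggGrad f S.x) - ∇ (globalFn f) (mean S.x))
    rw [sub_add_sub_cancel, ← hs] at h3
    have h4 := mean_aggGrad_sub_le A.m_ne_zero A.one_le_n A.differentiable A.smooth S.x
      (fun _ => mean S.x)
    rw [← gradient_globalFn A.differentiable] at h4
    have e : 1 / (m : ℝ) * ∑ i, ‖S.x i - mean S.x‖ ^ 2 = xErr S := by
      rw [xErr, consensusErrorSq]; ring
    rw [e] at h4
    rw [meanGradErr, ← hs]
    linarith
  have h5 := div_le_div_of_nonneg_right h2 (show (0 : ℝ) ≤ 4 * L by positivity)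
  have e : (2 * meanGradErr f S + 2 * (L ^ 2 * xErr S)) / (4 * L) =
      meanGradErr f S / (2 * L) + L * xErr S / 2 := by
    field_simp; ring
  linarith

/-- The weights in the Lyapunov function balance: the error in the mean gradient is paid by its own
decay at rate `p`, because `(1 - p) / (p m b) = n / (m b²) ≤ 1 / 36`. -/
lemma weighted_meanGradErr_le {U D : ℝ} (hD : 0 ≤ D) :
    (1 - P.p) * ((U + L ^ 2 / (m * P.b) * D) / (2 * L * P.p)) ≤
      U / (2 * L * P.p) - U / (2 * L) + L / 72 * D := by
  have hL := A.L_pos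
  have hm := A.m_pos
  have hb := A.b_pos
  have hn := A.n_pos
  have hp := A.p_pos
  have h1 : (1 - P.p) / P.p = n / P.b := by
    rw [A.p_eq]; field_simp; ring
  have e : (1 - P.p) * ((U + L ^ 2 / (m * P.b) * D) / (2 * L * P.p)) =
      U / (2 * L * P.p) - U / (2 * L) + L * D / 2 * (((1 - P.p) / P.p) / (m * P.b)) := by
    field_simp
  rw [e, h1]
  have h2 : (n : ℝ) / P.b / (m * P.b) ≤ 1 / 36 := by
    rw [div_div, div_le_div_iff₀ (by positivity) (by norm_num)]
    have := A.le_b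
    nlinarith
  have := mul_le_mul_of_nonneg_left h2 (show 0 ≤ L * D / 2 by positivity)
  linarith

/-- The Lyapunov function after a refresh of the gradients, `y = 1`: both estimation errors
vanish. -/
lemma indexExp_lyapunov_true_le (S : State m d) {B D : ℝ}
    (hB : consensusErrorSq (nextX W P S P.K) / m ≤ B) (hD : moveSq S (nextX W P S P.K) ≤ D) :
    indexExp (fun ξ => lyapunov f L P.p (step f W P (true, ξ) S)) ≤
      globalFn f (mean S.x - P.η • mean S.s) +
        1 / 50 * (sErr S + (2 * (L ^ 2 * D) + 2 * localGradErr f S)) / (80 * L) + L * B := by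
  have hL := A.L_pos
  refine le_trans (indexExp_mono fun ξ => ?_) (indexExp_const A.one_le_n _).le
  have h1 : meanGradErr f (step f W P (true, ξ) S) = 0 := by
    rw [meanGradErr, (step_true ξ S).1, (step_true ξ S).2.1]; simp
  have h2 : localGradErr f (step f W P (true, ξ) S) = 0 := by
    rw [localGradErr, (step_true ξ S).1, (step_true ξ S).2.1]; simp [aggGrad]
  have h3 : xErr (step f W P (true, ξ) S) ≤ B := by
    rw [xErr, (step_true ξ S).1]; exact hB
  have h4 : sErr (step f W P (true, ξ) S) ≤
      1 / 50 * (sErr S + (2 * (L ^ 2 * D) + 2 * localGradErr f S)) := by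
    have h5 := mul_le_mul_of_nonneg_left hD (sq_nonneg L)
    have h6 := sErr_step_true_le A ξ S
    linarith
  have h5 := div_le_div_of_nonneg_right h4 (show 0 ≤ 80 * L by positivity)
  have h6 := mul_le_mul_of_nonneg_left h3 hL.le
  rw [lyapunov, h1, h2, (step_true ξ S).1, mean_nextX A, zero_div, zero_div, add_zero, add_zero]
  linarith

/-- The Lyapunov function after a mini-batch correction, `y = 0`. -/
lemma indexExp_lyapunov_false_le (S : State m d) {B D : ℝ}
    (hB : consensusErrorSq (nextX W P S P.Khat) / m ≤ B)
    (hD : moveSq S (nextX W P S P.Khat) ≤ D) :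
    indexExp (fun ξ => lyapunov f L P.p (step f W P (false, ξ) S)) ≤
      globalFn f (mean S.x - P.η • mean S.s) +
        (meanGradErr f S + L ^ 2 / (m * P.b) * D) / (2 * L * P.p) +
        (localGradErr f S + L ^ 2 * D) / (2000 * L) +
        1 / 50 * (sErr S + L ^ 2 * D) / (80 * L) + L * B := by
  have hL := A.L_pos
  have hm := A.m_pos
  have hb := A.b_pos
  have hp := A.p_pos
  have h1 : ∀ ξ, lyapunov f L P.p (step f W P (false, ξ) S) ≤
      globalFn f (mean S.x - P.η • mean S.s) +
      1 / (2 * L * P.p) * meanGradErr f (step f W P (false, ξ) S) +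
      1 / (2000 * L) * localGradErr f (step f W P (false, ξ) S) +
      1 / (80 * L) * sErr (step f W P (false, ξ) S) + L * B := by
    intro ξ
    have h3 : xErr (step f W P (false, ξ) S) ≤ B := by
      rw [xErr, (step_false ξ S).1]; exact hB
    have h4 := mul_le_mul_of_nonneg_left h3 hL.le
    rw [lyapunov, (step_false ξ S).1, mean_nextX A, one_div_mul_eq_div,
      one_div_mul_eq_div, one_div_mul_eq_div]
    linarith
  refine (indexExp_mono h1).trans ?_
  simp only [indexExp_add, indexExp_mul, indexExp_const A.one_le_n]
  have hU := indexExp_meanGradErr_le A S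
  have hU' := mul_le_mul_of_nonneg_left hD (show 0 ≤ L ^ 2 / (m * P.b) by positivity)
  have hU'' := div_le_div_of_nonneg_right (hU.trans (add_le_add_right hU' _))
    (show 0 ≤ 2 * L * P.p by positivity)
  have hV := indexExp_localGradErr_le A S
  have hV' : L ^ 2 / P.b * moveSq S (nextX W P S P.Khat) ≤ L ^ 2 * D := by
    have hb1 : (1 : ℝ) ≤ P.b := by exact_mod_cast A.one_le_b
    have h2 : L ^ 2 / P.b ≤ L ^ 2 := div_le_self (by positivity) hb1
    have h0 : 0 ≤ moveSq S (nextX W P S P.Khat) := by rw [moveSq]; positivity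
    exact mul_le_mul h2 hD h0 (by positivity)
  have hV'' := div_le_div_of_nonneg_right (hV.trans (add_le_add_right hV' _))
    (show 0 ≤ 2000 * L by positivity)
  have hq := indexExp_sErr_le A S
  have hq' := mul_le_mul_of_nonneg_left hD (sq_nonneg L)
  have hq'' : indexExp (fun ξ => sErr (step f W P (false, ξ) S)) / (80 * L) ≤
      1 / 50 * (sErr S + L ^ 2 * D) / (80 * L) :=
    div_le_div_of_nonneg_right (by linarith) (by positivity)
  rw [one_div_mul_eq_div, one_div_mul_eq_div, one_div_mul_eq_div]
  linarith

/-- The Lyapunov function decreases in expectation in each iteration. -/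
theorem lyapunov_step_le (S : State m d) (hs : mean S.s = mean S.g) :
    ∑ z, noiseWeight P.p z * lyapunov f L P.p (step f W P z S) ≤
      lyapunov f L P.p S - ‖∇ (globalFn f) (mean S.x)‖ ^ 2 / (4 * L) - L / 4 * xErr S := by
  have hL := A.L_pos
  have hp := A.p_pos
  have h1p : 0 ≤ 1 - P.p := by linarith [A.p_le_one]
  have he0 := xErr_nonneg S
  have hq0 := sErr_nonneg S
  rw [sum_noiseWeight_mul]
  have htrue := mul_le_mul_of_nonneg_left (indexExp_lyapunov_true_le A S
    (consensusErrorSq_nextX_le A S A.le_K) (moveSq_nextX_le A S A.le_K)) hp.le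
  have hfalse := mul_le_mul_of_nonneg_left (indexExp_lyapunov_false_le A S
    (consensusErrorSq_nextX_le A S A.le_Khat) (moveSq_nextX_le A S A.le_Khat)) h1p
  have hdesc := descent_nextX A S hs P.K
  rw [mean_nextX A] at hdesc
  rw [lyapunov]
  have hd0 : 0 ≤ ‖P.η • mean S.s‖ ^ 2 := sq_nonneg _
  have hU := weighted_meanGradErr_le A (U := meanGradErr f S)
    (D := ‖P.η • mean S.s‖ ^ 2 + 2 * xErr S + 2 * (1 / 50 * (xErr S + sErr S / (4 * L ^ 2))))
    (by positivity)
  generalize indexExp (fun ξ => lyapunov f L P.p (step f W P (true, ξ) S)) = Φ₁ at *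
  generalize indexExp (fun ξ => lyapunov f L P.p (step f W P (false, ξ) S)) = Φ₀ at *
  generalize globalFn f (mean S.x - P.η • mean S.s) = F' at *
  generalize globalFn f (mean S.x) = F at *
  generalize ‖P.η • mean S.s‖ ^ 2 = d₁ at *
  generalize ‖∇ (globalFn f) (mean S.x)‖ ^ 2 / (4 * L) = N at *
  generalize (meanGradErr f S + L ^ 2 / (m * P.b) * (d₁ + 2 * xErr S +
    2 * (1 / 50 * (xErr S + sErr S / (4 * L ^ 2))))) / (2 * L * P.p) = U' at *
  generalize meanGradErr f S / (2 * L * P.p) = U₁ at *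
  generalize meanGradErr f S / (2 * L) = U₂ at *
  generalize localGradErr f S = V at *
  generalize xErr S = e at *
  obtain ⟨κ, hκ⟩ : ∃ κ, sErr S = 4 * L ^ 2 * κ := ⟨sErr S / (4 * L ^ 2), by field_simp⟩
  rw [hκ] at htrue hfalse hU hq0 ⊢
  have hκ0 : 0 ≤ κ := nonneg_of_mul_nonneg_right hq0 (by positivity)
  rw [show 4 * L ^ 2 * κ / (4 * L ^ 2) = κ by field_simp] at htrue hfalse hU
  obtain ⟨D, hD⟩ : ∃ D, D = d₁ + 2 * e + 2 * (1 / 50 * (e + κ)) := ⟨_, rfl⟩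
  rw [← hD] at htrue hfalse hU
  have e1 : 1 / 50 * (4 * L ^ 2 * κ + (2 * (L ^ 2 * D) + 2 * V)) / (80 * L) =
      L * κ / 1000 + L * D / 2000 + V / (2000 * L) := by
    field_simp; ring
  have e2 : 1 / 50 * (4 * L ^ 2 * κ + L ^ 2 * D) / (80 * L) = L * κ / 1000 + L * D / 4000 := by
    field_simp; ring
  have e3 : (V + L ^ 2 * D) / (2000 * L) = V / (2000 * L) + L * D / 2000 := by
    field_simp
  have e4 : 4 * L ^ 2 * κ / (80 * L) = L * κ / 20 := by
    field_simp; ring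
  rw [e1] at htrue
  rw [e2, e3] at hfalse
  rw [e4]
  have hLD : L * D = L * d₁ + 51 / 25 * (L * e) + 1 / 25 * (L * κ) := by rw [hD]; ring
  have hD0 : 0 ≤ P.p * (L * D) := by rw [hD]; positivity
  have hκL : 0 ≤ L * κ := by positivity
  have heL : 0 ≤ L * e := by positivity
  have hdL : 0 ≤ L * d₁ := by positivity
  generalize V / (2000 * L) = V₁ at *
  linarith

end Step

/-! ### Stationarity of the output -/

section Output

variable {m n d : ℕ} {f : Fin m → Fin n → Vec d → ℝ} {W : Matrix (Fin m) (Fin m) ℝ}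
  {L : ℝ} {P : Params} (A : Setting f W L P) (x₀ : Vec d)
include A

lemma runExp_mono {F F' : (Fin P.T → Noise m n P.b) → ℝ} (h : ∀ ω, F ω ≤ F' ω) :
    runExp P F ≤ runExp P F' :=
  prodExp_mono (noiseWeight_nonneg A.p_pos.le A.p_le_one) h

lemma runExp_const (c : ℝ) : runExp P (fun _ : Fin P.T → Noise m n P.b => c) = c :=
  prodExp_const (sum_noiseWeight A.one_le_n P.p) c

/-- The gradient trackers have the same mean as the gradient estimators. -/
lemma mean_s_run (ω : Fin P.T → Noise m n P.b) (t : ℕ) :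
    mean (run f W x₀ P ω t).s = mean (run f W x₀ P ω t).g := by
  induction t with
  | zero => exact A.mean_fastMix _ _
  | succ t ih =>
    rw [run]
    split_ifs with h
    · exact mean_s_step A _ ih
    · exact ih

lemma sum_decrease_le (t : ℕ) (ht : t ≤ P.T) :
    runExp P (fun ω : Fin P.T → Noise m n P.b => lyapunov f L P.p (run f W x₀ P ω t)) +
      ∑ k ∈ Finset.range t, runExp P (fun ω : Fin P.T → Noise m n P.b =>
        ‖∇ (globalFn f) (mean (run f W x₀ P ω k).x)‖ ^ 2 / (4 * L) +
          L / 4 * xErr (run f W x₀ P ω k)) ≤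
      lyapunov f L P.p (initState f W x₀ P) := by
  induction t with
  | zero =>
    simp only [run, Finset.range_zero, Finset.sum_empty, add_zero]
    exact (runExp_const A _).le
  | succ t ih =>
    have h := ih (by omega)
    rw [Finset.sum_range_succ, runExp_succ f W x₀ P A.one_le_n (by omega)]
    have h1 : runExp P (fun ω : Fin P.T → Noise m n P.b => ∑ z : Noise m n P.b,
          noiseWeight P.p z * lyapunov f L P.p (step f W P z (run f W x₀ P ω t))) +
        runExp P (fun ω : Fin P.T → Noise m n P.b =>
          ‖∇ (globalFn f) (mean (run f W x₀ P ω t).x)‖ ^ 2 / (4 * L) +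
            L / 4 * xErr (run f W x₀ P ω t)) ≤
        runExp P (fun ω : Fin P.T → Noise m n P.b => lyapunov f L P.p (run f W x₀ P ω t)) := by
      rw [runExp, runExp, ← prodExp_add]
      refine runExp_mono A fun ω => ?_
      have := lyapunov_step_le A (run f W x₀ P ω t) (mean_s_run A x₀ ω t)
      linarith
    linarith

lemma globalFn_le_lyapunov (S : State m d) : globalFn f (mean S.x) ≤ lyapunov f L P.p S := by
  have := A.L_pos
  have := A.p_pos
  have h1 := xErr_nonneg S
  have h2 := sErr_nonneg S
  have h3 := meanGradErr_nonneg (f := f) S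
  have h4 := localGradErr_nonneg (f := f) S
  have : 0 ≤ meanGradErr f S / (2 * L * P.p) + localGradErr f S / (2000 * L) +
    sErr S / (80 * L) + L * xErr S := by positivity
  rw [lyapunov]
  linarith

lemma lyapunov_initState :
    lyapunov f L P.p (initState f W x₀ P) =
      globalFn f x₀ + sErr (initState f W x₀ P) / (80 * L) := by
  have h1 : xErr (initState f W x₀ P) = 0 := by
    simp [xErr, consensusErrorSq, initState, mean_const A.m_ne_zero]
  have h2 : localGradErr f (initState f W x₀ P) = 0 := by
    simp [localGradErr, initState, aggGrad]
  have h3 : meanGradErr f (initState f W x₀ P) = 0 := by simp [meanGradErr, initState]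
  have h4 : mean (initState f W x₀ P).x = x₀ := mean_const A.m_ne_zero x₀
  rw [lyapunov, h1, h2, h3, h4]
  ring

/-- The initial mixing brings the consensus error of the gradients down to the order `ε²`. -/
lemma sErr_initState_le {ε : ℝ} (hε : 0 < ε)
    (hKin : Real.log (consensusErrorSq (aggGrad f fun _ => x₀) / (m * ε ^ 2)) ≤
      P.Kin * √(1 - lambda2 W)) :
    sErr (initState f W x₀ P) ≤ 3 * ε ^ 2 := by
  have hm := A.m_pos
  have h1 := consensusErrorSq_fastMix_le A.two_le_m A.posSemidef A.mulVec_one A.lambda2_lt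
    (aggGrad f fun _ => x₀) P.Kin
  rw [sErr, div_le_iff₀ hm]
  refine h1.trans ?_
  set H := consensusErrorSq (aggGrad f fun _ => x₀)
  rcases (consensusErrorSq_nonneg (aggGrad f fun _ => x₀)).eq_or_lt with h0 | h0
  · have : H = 0 := h0.symm
    rw [this, mul_zero]
    positivity
  · have h2 : Real.exp (-(P.Kin * √(1 - lambda2 W))) ≤ m * ε ^ 2 / H := by
      calc Real.exp (-(P.Kin * √(1 - lambda2 W)))
          ≤ Real.exp (-Real.log (H / (m * ε ^ 2))) := Real.exp_le_exp.2 (neg_le_neg hKin)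
        _ = m * ε ^ 2 / H := by
          rw [← Real.log_inv, inv_div, Real.exp_log (by positivity)]
    calc 3 * Real.exp (-(P.Kin * √(1 - lambda2 W))) * H ≤ 3 * (m * ε ^ 2 / H) * H := by gcongr
      _ = 3 * ε ^ 2 * m := by
        have : H ≠ 0 := h0.ne'
        field_simp

lemma sum_norm_gradient_le {ε : ℝ} (hε : 0 < ε) (S : State m d) :
    ∑ i, ‖∇ (globalFn f) (S.x i)‖ ≤ m * (ε / 2 + 4 * L / ε *
      (‖∇ (globalFn f) (mean S.x)‖ ^ 2 / (4 * L) + L / 4 * xErr S)) := by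
  have hL := A.L_pos
  have hm := A.m_pos
  have h : ∀ i, ‖∇ (globalFn f) (S.x i)‖ ≤
      ε / 2 + (‖∇ (globalFn f) (mean S.x)‖ ^ 2 + L ^ 2 * ‖S.x i - mean S.x‖ ^ 2) / ε := by
    intro i
    have h1 := norm_add_sq_le_two (∇ (globalFn f) (mean S.x))
      (∇ (globalFn f) (S.x i) - ∇ (globalFn f) (mean S.x))
    rw [add_sub_cancel] at h1
    have h2 := pow_le_pow_left₀ (norm_nonneg _) (A.gradient_lipschitz (S.x i) (mean S.x)) 2
    rw [mul_pow] at h2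
    set a := ‖∇ (globalFn f) (S.x i)‖
    set c := ‖∇ (globalFn f) (mean S.x)‖ ^ 2 + L ^ 2 * ‖S.x i - mean S.x‖ ^ 2
    have h3 : a ^ 2 ≤ 2 * c := by simp only [c]; linarith
    have h4 : ε / 2 + c / ε = (ε ^ 2 + 2 * c) / (2 * ε) := by field_simp
    rw [h4, le_div_iff₀ (by positivity)]
    nlinarith [sq_nonneg (a - ε)]
  refine (Finset.sum_le_sum fun i _ => h i).trans (le_of_eq ?_)
  rw [Finset.sum_add_distrib, ← Finset.sum_div Finset.univ (fun i => _ + _), Finset.sum_add_distrib,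
    ← Finset.mul_sum, xErr, consensusErrorSq]
  simp only [Finset.sum_const, Finset.card_univ, Fintype.card_fin, nsmul_eq_mul]
  field_simp

theorem expect_norm_gradient_xOut_le {ε fmin : ℝ} (hε : 0 < ε) (hT : 1 ≤ P.T)
    (hT' : 16 * L * (globalFn f x₀ - fmin) / ε ^ 2 ≤ P.T) (hmin : ∀ x, fmin ≤ globalFn f x)
    (hKin : Real.log (consensusErrorSq (aggGrad f fun _ => x₀) / (m * ε ^ 2)) ≤
      P.Kin * √(1 - lambda2 W)) :
    expect P (fun ω : Sample m n P => ‖∇ (globalFn f) (xOut f W x₀ P ω)‖) ≤ ε := by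
  have hL := A.L_pos
  have hm := A.m_pos
  have hT1 : (1 : ℝ) ≤ P.T := by exact_mod_cast hT
  have hT0 : (0 : ℝ) < P.T := by linarith
  set R : (Fin P.T → Noise m n P.b) → ℕ → ℝ := fun ω t =>
    ‖∇ (globalFn f) (mean (run f W x₀ P ω t).x)‖ ^ 2 / (4 * L) +
      L / 4 * xErr (run f W x₀ P ω t) with hR
  have hsum : ∑ t ∈ Finset.range P.T, runExp P (fun ω => R ω t) ≤
      globalFn f x₀ - fmin + 3 * ε ^ 2 / (80 * L) := by
    have h1 := sum_decrease_le A x₀ P.T le_rfl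
    rw [lyapunov_initState A] at h1
    have h2 : fmin ≤ runExp P (fun ω : Fin P.T → Noise m n P.b =>
        lyapunov f L P.p (run f W x₀ P ω P.T)) := by
      refine (runExp_const A fmin).symm.le.trans (runExp_mono A fun ω => ?_)
      exact (hmin _).trans (globalFn_le_lyapunov A _)
    have h3 := div_le_div_of_nonneg_right (sErr_initState_le A x₀ hε hKin)
      (show 0 ≤ 80 * L by positivity)
    linarith
  rw [expect_eq]
  have h1 : ∀ ω : Fin P.T → Noise m n P.b,
      1 / ((P.T : ℝ) * m) * ∑ t : Fin P.T, ∑ i,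
        ‖∇ (globalFn f) (xOut f W x₀ P (ω, (t, i)))‖ ≤
      ε / 2 + 4 * L / (ε * P.T) * ∑ t ∈ Finset.range P.T, R ω t := by
    intro ω
    have h2 : ∑ t : Fin P.T, ∑ i, ‖∇ (globalFn f) (xOut f W x₀ P (ω, (t, i)))‖ ≤
        ∑ t ∈ Finset.range P.T, m * (ε / 2 + 4 * L / ε * R ω t) := by
      rw [← Fin.sum_univ_eq_sum_range (fun t => m * (ε / 2 + 4 * L / ε * R ω t))]
      exact Finset.sum_le_sum fun t _ => sum_norm_gradient_le A hε (run f W x₀ P ω t)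
    refine (mul_le_mul_of_nonneg_left h2 (by positivity)).trans (le_of_eq ?_)
    generalize R ω = ρ
    rw [← Finset.mul_sum, Finset.sum_add_distrib, ← Finset.mul_sum]
    simp only [Finset.sum_const, Finset.card_range, nsmul_eq_mul]
    field_simp
  refine (runExp_mono A h1).trans ?_
  have h2 : runExp P (fun ω : Fin P.T → Noise m n P.b =>
      ε / 2 + 4 * L / (ε * P.T) * ∑ t ∈ Finset.range P.T, R ω t) =
      ε / 2 + 4 * L / (ε * P.T) * ∑ t ∈ Finset.range P.T, runExp P (fun ω => R ω t) := by
    have := runExp_const A (ε / 2)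
    simp only [runExp] at this ⊢
    rw [prodExp_add, prodExp_mul, prodExp_sum, this]
  rw [h2]
  have h3 := mul_le_mul_of_nonneg_left hsum (show 0 ≤ 4 * L / (ε * P.T) by positivity)
  have h4 : 4 * L / (ε * P.T) * (globalFn f x₀ - fmin + 3 * ε ^ 2 / (80 * L)) =
      ε / 4 * (16 * L * (globalFn f x₀ - fmin) / ε ^ 2 / P.T) + 3 * ε / 20 * (1 / P.T) := by
    field_simp; ring
  have h5 : 16 * L * (globalFn f x₀ - fmin) / ε ^ 2 / P.T ≤ 1 := (div_le_one hT0).2 hT'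
  have h6 : 1 / (P.T : ℝ) ≤ 1 := (div_le_one hT0).2 hT1
  have h7 := mul_le_mul_of_nonneg_left h5 (show 0 ≤ ε / 4 by positivity)
  have h8 := mul_le_mul_of_nonneg_left h6 (show 0 ≤ 3 * ε / 20 by positivity)
  linarith

/-! ### Expected costs -/

lemma runExp_of_increment (F : State m d → ℝ) (c : ℝ)
    (hF : ∀ S, ∑ z : Noise m n P.b, noiseWeight P.p z * F (step f W P z S) = F S + c) (t : ℕ)
    (ht : t ≤ P.T) :
    runExp P (fun ω : Fin P.T → Noise m n P.b => F (run f W x₀ P ω t)) =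
      F (initState f W x₀ P) + t * c := by
  induction t with
  | zero => simp only [run]; rw [runExp_const A]; simp
  | succ t ih =>
    rw [runExp_succ f W x₀ P A.one_le_n (by omega)]
    simp only [hF]
    have h := runExp_const A c
    have h2 := ih (by omega)
    simp only [runExp] at h h2 ⊢
    rw [prodExp_add, h, h2]
    push_cast; ring

lemma expect_ifoCalls (hT : 1 ≤ P.T) (i : Fin m) :
    expect P (fun ω : Sample m n P => (ifoCalls f W x₀ P i ω : ℝ)) =
      n + P.T * (P.p * n + (1 - P.p) * (2 * P.b)) := by
  refine (expect_of_run P A.m_ne_zero (by omega) fun ω => ((run f W x₀ P ω P.T).ifo i : ℝ)).trans ?_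
  refine runExp_of_increment A x₀ (fun S => (S.ifo i : ℝ)) _ (fun S => ?_) P.T le_rfl
  rw [sum_noiseWeight_mul]
  simp only [step, if_true, Bool.false_eq_true, if_false]
  rw [indexExp_const A.one_le_n, indexExp_const A.one_le_n]
  push_cast; ring

lemma expect_commRounds (hT : 1 ≤ P.T) :
    expect P (fun ω : Sample m n P => (commRounds f W x₀ P ω : ℝ)) =
      P.Kin + P.T * (P.p * (2 * P.K) + (1 - P.p) * (2 * P.Khat)) := by
  refine (expect_of_run P A.m_ne_zero (by omega) fun ω => ((run f W x₀ P ω P.T).comm : ℝ)).trans ?_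
  refine runExp_of_increment A x₀ (fun S => (S.comm : ℝ)) _ (fun S => ?_) P.T le_rfl
  rw [sum_noiseWeight_mul]
  simp only [step, if_true, Bool.false_eq_true, if_false]
  rw [indexExp_const A.one_le_n, indexExp_const A.one_le_n]
  push_cast; ring

end Output

lemma natCeil_le_max_add_one (a : ℝ) : (⌈a⌉₊ : ℝ) ≤ max 0 a + 1 := by
  rcases le_total a 0 with h | h
  · rw [Nat.ceil_eq_zero.2 h, max_eq_left h]; norm_num
  · rw [max_eq_right h]; exact (Nat.ceil_lt_add_one h).le

/-- Gradient refreshes happen with probability `p`, which compensates for the logarithm in the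
number of their communication rounds. -/
lemma prob_mul_log_le {m n b : ℕ} (hm : 2 ≤ m) (hn : 1 ≤ n)
    (hb : (b : ℝ) ≤ 6 * √((n : ℝ) / m) + 1) :
    (b : ℝ) / (b + n) * max 0 (Real.log ((√((m : ℝ) * n) + 6) / (24 * m))) ≤ 1 := by
  have hm' : (2 : ℝ) ≤ m := by exact_mod_cast hm
  have hn' : (0 : ℝ) < n := by exact_mod_cast hn
  have hb0 : (0 : ℝ) ≤ b := Nat.cast_nonneg b
  set r := √((n : ℝ) / m) with hr
  have hr0 : 0 < r := Real.sqrt_pos.2 (by positivity)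
  have hnr : (n : ℝ) = m * r ^ 2 := by
    rw [hr, Real.sq_sqrt (by positivity)]; field_simp
  have hmn : √((m : ℝ) * n) = m * r := by
    rw [hnr, show (m : ℝ) * (m * r ^ 2) = (m * r) ^ 2 by ring]
    exact Real.sqrt_sq (by positivity)
  rw [hmn]
  set y := (m * r + 6) / (24 * (m : ℝ)) with hy
  have hy0 : 0 < y := by positivity
  have hlog : max 0 (Real.log y) ≤ y := max_le hy0.le (by
    have := Real.log_le_sub_one_of_pos hy0; linarith)
  have hyr : y ≤ (r + 3) / 24 := by
    rw [hy, div_le_div_iff₀ (by positivity) (by norm_num)]; nlinarith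
  rcases le_total r 1 with h | h
  · have h1 : (b : ℝ) / (b + n) ≤ 1 := (div_le_one (by positivity)).2 (by linarith)
    calc (b : ℝ) / (b + n) * max 0 (Real.log y) ≤ 1 * y := by gcongr
      _ ≤ 1 := by linarith
  · have h1 : (b : ℝ) / (b + n) ≤ (6 * r + 1) / n := by
      gcongr; linarith
    calc (b : ℝ) / (b + n) * max 0 (Real.log y) ≤ (6 * r + 1) / n * ((r + 3) / 24) := by
          gcongr; exact hlog.trans hyr
      _ ≤ 1 := by
        rw [div_mul_div_comm, div_le_one (by positivity), hnr]
        nlinarith [mul_le_mul_of_nonneg_right hm' (sq_nonneg r)]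

/-- The costs of `T ≤ 16 Z + 1` iterations in gradient evaluations. -/
lemma ifo_bound {m n b : ℕ} {T p Z : ℝ} (hm : 2 ≤ m) (hn : 1 ≤ n)
    (hb : (b : ℝ) ≤ 6 * √((n : ℝ) / m) + 1) (hp : p = (b : ℝ) / (b + n)) (hZ : 0 ≤ Z)
    (hT0 : 0 ≤ T) (hT : T ≤ 16 * Z + 1) :
    n + T * (p * n + (1 - p) * (2 * b)) ≤ 480 * (n + max 1 √((n : ℝ) / m) * Z) := by
  have hm' : (2 : ℝ) ≤ m := by exact_mod_cast hm
  have hn' : (1 : ℝ) ≤ n := by exact_mod_cast hn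
  have hb0 : (0 : ℝ) ≤ b := Nat.cast_nonneg b
  have hp0 : 0 ≤ p := by rw [hp]; positivity
  set M := max 1 √((n : ℝ) / m)
  have hM1 : 1 ≤ M := le_max_left _ _
  have hrM : √((n : ℝ) / m) ≤ M := le_max_right _ _
  have hMn : M ≤ n := by
    refine max_le hn' (Real.sqrt_le_iff.2 ⟨by linarith, ?_⟩)
    rw [div_le_iff₀ (by linarith)]
    nlinarith
  have hpn : p * n ≤ b := by
    rw [hp, div_mul_eq_mul_div, div_le_iff₀ (by positivity)]
    nlinarith [sq_nonneg (b : ℝ)]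
  have hc : p * n + (1 - p) * (2 * b) ≤ 21 * M := by
    have : 0 ≤ p * (2 * b) := by positivity
    linarith
  have h1 : T * (p * n + (1 - p) * (2 * b)) ≤ T * (21 * M) := mul_le_mul_of_nonneg_left hc hT0
  have h2 : T * (21 * M) ≤ (16 * Z + 1) * (21 * M) :=
    mul_le_mul_of_nonneg_right hT (by positivity)
  have hMZ : 0 ≤ M * Z := by positivity
  linarith

/-- The costs of `T ≤ 16 Z + 1` iterations in communication rounds, where `σ = √(1 - λ₂)`, `ℓ` is
the logarithm in `K` and `h` the one in `K_in`. -/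
lemma comm_bound {T p Z σ ℓ h K Khat Kin : ℝ} (hσ0 : 0 < σ) (hσ1 : σ ≤ 1) (hp0 : 0 ≤ p)
    (hp1 : p ≤ 1) (hpl : p * max 0 ℓ ≤ 1) (hZ : 0 ≤ Z) (hT0 : 0 ≤ T) (hT : T ≤ 16 * Z + 1)
    (hh : 0 ≤ h) (hK : K ≤ max 12 ℓ / (2 * σ) + 1) (hKhat0 : 0 ≤ Khat) (hKhat : Khat ≤ 6 / σ + 1)
    (hKin : Kin ≤ h / σ + 1) :
    Kin + T * (p * (2 * K) + (1 - p) * (2 * Khat)) ≤ 480 * ((Z + h + 1) / σ) := by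
  obtain ⟨τ, hτ⟩ : ∃ τ, τ = 1 / σ := ⟨_, rfl⟩
  have h1τ : 1 ≤ τ := by rw [hτ, le_div_iff₀ hσ0]; linarith
  have e1 : 6 / σ = 6 * τ := by rw [hτ]; ring
  have e2 : h / σ = h * τ := by rw [hτ]; ring
  have e3 : max 12 ℓ / (2 * σ) = max 12 ℓ / 2 * τ := by rw [hτ]; field_simp
  have e4 : (Z + h + 1) / σ = Z * τ + h * τ + τ := by rw [hτ]; ring
  rw [e3] at hK
  rw [e1] at hKhat
  rw [e2] at hKin
  rw [e4]
  have h2 : max 12 ℓ ≤ 12 + max 0 ℓ := max_le (by linarith [le_max_left 0 ℓ])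
    (by linarith [le_max_right 0 ℓ])
  have hK' : K ≤ (7 + max 0 ℓ / 2) * τ := by
    have := mul_le_mul_of_nonneg_right h2 (by linarith : 0 ≤ τ)
    linarith
  have hpK : p * (2 * K) ≤ 15 * τ := by
    have h3 := mul_le_mul_of_nonneg_left hK' hp0
    have h4 := mul_le_mul_of_nonneg_right hpl (by linarith : 0 ≤ τ)
    have h5 := mul_le_mul_of_nonneg_right hp1 (by linarith : 0 ≤ τ)
    linarith
  have hpKhat : (1 - p) * (2 * Khat) ≤ 14 * τ := by
    have := mul_nonneg hp0 hKhat0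
    linarith
  have h3 : T * (p * (2 * K) + (1 - p) * (2 * Khat)) ≤ T * (29 * τ) :=
    mul_le_mul_of_nonneg_left (by linarith) hT0
  have h4 : T * (29 * τ) ≤ (16 * Z + 1) * (29 * τ) :=
    mul_le_mul_of_nonneg_right hT (by linarith)
  have h5 : 0 ≤ Z * τ := mul_nonneg hZ (by linarith)
  have h6 : 0 ≤ h * τ := mul_nonneg hh (by linarith)
  linarith

lemma ifo_bound_of_le {m n L Δ ε κ : ℝ} (hm : 0 < m) (hn : 0 < n) (hL : 0 < L) (hε : 0 < ε)
    (hΔ : 0 ≤ Δ) (hκ : 1 ≤ κ) (hΔκ : Δ ≤ κ) (hmκ : m ≤ κ * n) :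
    n + max 1 √(n / m) * (L * Δ / ε ^ 2) ≤ κ ^ 2 * (n + √(n / m) * (L / ε ^ 2)) := by
  set r := √(n / m) with hr
  have hr0 : 0 < r := Real.sqrt_pos.2 (by positivity)
  have hr2 : r ^ 2 = n / m := Real.sq_sqrt (by positivity)
  have h1 : 1 ≤ κ * r ^ 2 := by
    rw [hr2, mul_div_assoc', le_div_iff₀ hm]; linarith
  have hκr : max 1 r ≤ κ * r := by
    refine max_le ?_ (le_mul_of_one_le_left hr0.le hκ)
    rcases le_total r 1 with h | h
    · exact h1.trans (mul_le_mul_of_nonneg_left (by nlinarith) (by linarith))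
    · nlinarith
  have hZκ : L * Δ / ε ^ 2 ≤ κ * (L / ε ^ 2) := by
    have h2 := mul_le_mul_of_nonneg_right hΔκ (show 0 ≤ L / ε ^ 2 by positivity)
    have h3 : L * Δ / ε ^ 2 = Δ * (L / ε ^ 2) := by ring
    linarith
  have h2 := mul_le_mul hκr hZκ (by positivity) (by positivity)
  have h3 : n ≤ κ ^ 2 * n := le_mul_of_one_le_left hn.le (one_le_pow₀ hκ)
  linarith

lemma comm_bound_of_le {L Δ H ε κ σ : ℝ} (hL : 0 < L) (hε : 0 < ε) (hσ : 0 < σ) (hH : 0 ≤ H)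
    (hκ : 1 ≤ κ) (hΔκ : Δ ≤ κ) (hHκ : H ≤ κ * L) (hεκ : ε ^ 2 ≤ κ * L) :
    (L * Δ / ε ^ 2 + max 0 (Real.log (H / ε ^ 2)) + 1) / σ ≤ 3 * (κ ^ 2 * (L / ε ^ 2 / σ)) := by
  obtain ⟨q, hq⟩ : ∃ q, q = L / ε ^ 2 := ⟨_, rfl⟩
  have hq0 : 0 < q := by rw [hq]; positivity
  have hκq : κ * L / ε ^ 2 = κ * q := by rw [hq]; ring
  have hZκ : L * Δ / ε ^ 2 ≤ κ * q := by
    have h2 := mul_le_mul_of_nonneg_right hΔκ hq0.le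
    have h3 : L * Δ / ε ^ 2 = Δ * q := by rw [hq]; ring
    linarith
  have h1 : 1 ≤ κ * q := by
    rw [← hκq, le_div_iff₀ (by positivity)]; linarith
  have h2 : max 0 (Real.log (H / ε ^ 2)) ≤ κ * q := by
    refine max_le (by positivity) ((Real.log_le_self (by positivity)).trans ?_)
    rw [← hκq]
    exact div_le_div_of_nonneg_right hHκ (by positivity)
  have h3 : κ * q ≤ κ ^ 2 * q := mul_le_mul_of_nonneg_right (by nlinarith) hq0.le
  rw [← hq, show 3 * (κ ^ 2 * (q / σ)) = 3 * (κ ^ 2 * q) / σ by ring]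
  exact div_le_div_of_nonneg_right (by linarith) hσ.le

end

end Dearest

theorem theorem1 :
    ∃ C : ℝ, 0 < C ∧
      ∀ (m n d : ℕ) (f : Fin m → Fin n → Dearest.Vec d → ℝ) (G : SimpleGraph (Fin m))
        (W : Matrix (Fin m) (Fin m) ℝ) (x₀ : Dearest.Vec d) (L ε fstar Δ H : ℝ)
        (P : Dearest.Params),
      2 ≤ m → 1 ≤ n → 0 < L → 0 < ε →
      -- the network and the gossip matrix
      G.Connected →
      W.IsSymm →
      (∀ i j, i ≠ j → ¬ G.Adj i j → W i j = 0) →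
      W.mulVec (fun _ => (1 : ℝ)) = (fun _ => 1) →
      W.PosSemidef →
      Dearest.lambda2 W < 1 →
      -- the objective
      (∀ i j, Differentiable ℝ (f i j)) →
      Dearest.AverageSmooth f L →
      BddBelow (Set.range (Dearest.globalFn f)) →
      fstar = ⨅ x, Dearest.globalFn f x →
      Δ = Dearest.globalFn f x₀ - fstar →
      0 < Δ →
      -- `H = ‖g₀ - 𝟏 ḡ₀‖² / m`
      H = Dearest.consensusErrorSq (Dearest.aggGrad f (fun _ => x₀)) / (m : ℝ) →
      -- the parameters
      P.η = 1 / (2 * L) →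
      P.b = ⌈6 * √((n : ℝ) / (m : ℝ))⌉₊ →
      P.p = (P.b : ℝ) / ((P.b : ℝ) + (n : ℝ)) →
      P.T = ⌈16 * L * (Dearest.globalFn f x₀ - fstar) / ε ^ 2⌉₊ →
      P.K = ⌈max 12 (Real.log ((√((m : ℝ) * (n : ℝ)) + 6) / (24 * (m : ℝ)))) /
        (2 * √(1 - Dearest.lambda2 W))⌉₊ →
      P.Khat = ⌈6 / √(1 - Dearest.lambda2 W)⌉₊ →
      P.Kin = ⌈Real.log (Dearest.consensusErrorSq (Dearest.aggGrad f (fun _ => x₀)) /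
        ((m : ℝ) * ε ^ 2)) / √(1 - Dearest.lambda2 W)⌉₊ →
      -- the output is `ε`-stationary in expectation
      Dearest.expect P (fun ω => ‖gradient (Dearest.globalFn f) (Dearest.xOut f W x₀ P ω)‖) ≤ ε ∧
      -- IFO calls of each agent and communication rounds, with an absolute constant
      (∀ i, Dearest.expect P (fun ω => (Dearest.ifoCalls f W x₀ P i ω : ℝ)) ≤
        C * ((n : ℝ) + max 1 √((n : ℝ) / (m : ℝ)) * (L * Δ / ε ^ 2))) ∧
      Dearest.expect P (fun ω => (Dearest.commRounds f W x₀ P ω : ℝ)) ≤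
        C * ((L * Δ / ε ^ 2 + max 0 (Real.log (H / ε ^ 2)) + 1) / √(1 - Dearest.lambda2 W)) ∧
      -- the same in the form `O(n + √(n/m) L ε⁻²)` and `O(L ε⁻² / √(1 - λ₂(W)))`
      (∀ κ : ℝ, 1 ≤ κ → Δ ≤ κ →
        ((m : ℝ) ≤ κ * (n : ℝ) →
          ∀ i, Dearest.expect P (fun ω => (Dearest.ifoCalls f W x₀ P i ω : ℝ)) ≤
            C * κ ^ 2 * ((n : ℝ) + √((n : ℝ) / (m : ℝ)) * (L / ε ^ 2))) ∧
        (H ≤ κ * L → ε ^ 2 ≤ κ * L →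
          Dearest.expect P (fun ω => (Dearest.commRounds f W x₀ P ω : ℝ)) ≤
            C * κ ^ 2 * ((L / ε ^ 2) / √(1 - Dearest.lambda2 W)))) := by
  -- the costs have constant `480`; the bound in terms of `κ` has three terms of the same order
  refine ⟨1500, by norm_num, ?_⟩
  intro m n d f G W x₀ L ε fstar Δ H P hm hn hL hε _ _ _ hW1 hW hl hf hsm hbdd hfstar hΔ hΔ0 hH
    hη hb hp hT hK hKhat hKin
  have hm' : (0 : ℝ) < m := by positivity
  have hn' : (0 : ℝ) < n := by positivity
  have hl0 := Dearest.lambda2_nonneg hm hW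
  have hσ0 : 0 < √(1 - Dearest.lambda2 W) := Real.sqrt_pos.2 (by linarith)
  have hσ1 : √(1 - Dearest.lambda2 W) ≤ 1 := Real.sqrt_le_one.2 (by linarith)
  have hr0 : 0 < √((n : ℝ) / m) := Real.sqrt_pos.2 (by positivity)
  have hb_ge : 6 * √((n : ℝ) / m) ≤ P.b := by rw [hb]; exact Nat.le_ceil _
  have hb_le : (P.b : ℝ) ≤ 6 * √((n : ℝ) / m) + 1 := by
    rw [hb]; exact (Nat.ceil_lt_add_one (by positivity)).le
  have A : Dearest.Setting f W L P :=
    { two_le_m := hm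
      one_le_n := hn
      L_pos := hL
      posSemidef := hW
      mulVec_one := hW1
      lambda2_lt := hl
      differentiable := hf
      smooth := hsm
      η_eq := hη
      one_le_b := by rw [hb]; exact Nat.one_le_ceil_iff.2 (by positivity)
      le_b := by
        have h1 := pow_le_pow_left₀ (by positivity) hb_ge 2
        rw [mul_pow, Real.sq_sqrt (by positivity), mul_div_assoc', div_le_iff₀ hm'] at h1
        linarith
      p_eq := hp
      le_K := by
        have h1 := Nat.le_ceil (max 12 (Real.log ((√((m : ℝ) * n) + 6) / (24 * m))) /
          (2 * √(1 - Dearest.lambda2 W)))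
        rw [← hK, div_le_iff₀ (by positivity)] at h1
        have h2 := le_max_left 12 (Real.log ((√((m : ℝ) * n) + 6) / (24 * m)))
        linarith
      le_Khat := by
        have h1 := Nat.le_ceil (6 / √(1 - Dearest.lambda2 W))
        rwa [← hKhat, div_le_iff₀ hσ0] at h1 }
  have hZ0 : 0 < L * Δ / ε ^ 2 := by positivity
  have hTZ : 16 * L * (Dearest.globalFn f x₀ - fstar) / ε ^ 2 = 16 * (L * Δ / ε ^ 2) := by
    rw [← hΔ]; ring
  have hT_le : (P.T : ℝ) ≤ 16 * (L * Δ / ε ^ 2) + 1 := by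
    rw [hT, hTZ]; exact (Nat.ceil_lt_add_one (by positivity)).le
  have hT1 : 1 ≤ P.T := by rw [hT, hTZ]; exact Nat.one_le_ceil_iff.2 (by positivity)
  have hHε : Dearest.consensusErrorSq (Dearest.aggGrad f (fun _ => x₀)) / ((m : ℝ) * ε ^ 2) =
      H / ε ^ 2 := by rw [hH, div_div]
  have hH0 : 0 ≤ H := by
    rw [hH]; exact div_nonneg (Dearest.consensusErrorSq_nonneg _) hm'.le
  have hifo : ∀ i, Dearest.expect P (fun ω => (Dearest.ifoCalls f W x₀ P i ω : ℝ)) ≤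
      480 * ((n : ℝ) + max 1 √((n : ℝ) / m) * (L * Δ / ε ^ 2)) := fun i => by
    rw [Dearest.expect_ifoCalls A x₀ hT1]
    exact Dearest.ifo_bound hm hn hb_le hp hZ0.le (Nat.cast_nonneg _) hT_le
  have hcomm : Dearest.expect P (fun ω => (Dearest.commRounds f W x₀ P ω : ℝ)) ≤
      480 * ((L * Δ / ε ^ 2 + max 0 (Real.log (H / ε ^ 2)) + 1) /
        √(1 - Dearest.lambda2 W)) := by
    rw [Dearest.expect_commRounds A x₀ hT1]
    refine Dearest.comm_bound hσ0 hσ1 A.p_pos.le A.p_le_one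
      (by rw [hp]; exact Dearest.prob_mul_log_le hm hn hb_le) hZ0.le (Nat.cast_nonneg _) hT_le
      (le_max_left _ _) ?_ (Nat.cast_nonneg _) ?_ ?_
    · rw [hK]
      have h12 := le_max_left 12 (Real.log ((√((m : ℝ) * n) + 6) / (24 * m)))
      exact (Nat.ceil_lt_add_one (div_nonneg (by linarith) (by positivity))).le
    · rw [hKhat]
      exact (Nat.ceil_lt_add_one (by positivity)).le
    · rw [hKin, hHε]
      refine (Dearest.natCeil_le_max_add_one _).trans (add_le_add_left (max_le ?_ ?_) 1)
      · exact div_nonneg (le_max_left _ _) hσ0.le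
      · exact div_le_div_of_nonneg_right (le_max_right _ _) hσ0.le
  refine ⟨?_, fun i => (hifo i).trans ?_, hcomm.trans ?_, fun κ hκ hΔκ => ⟨fun hmκ i => ?_,
    fun hHκ hεκ => ?_⟩⟩
  · refine Dearest.expect_norm_gradient_xOut_le A x₀ (fmin := fstar) hε hT1
      (by rw [hT]; exact Nat.le_ceil _) (fun x => by rw [hfstar]; exact ciInf_le hbdd x) ?_
    have h1 := Nat.le_ceil (Real.log (Dearest.consensusErrorSq
      (Dearest.aggGrad f (fun _ => x₀)) / ((m : ℝ) * ε ^ 2)) / √(1 - Dearest.lambda2 W))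
    rwa [← hKin, div_le_iff₀ hσ0] at h1
  · exact mul_le_mul_of_nonneg_right (by norm_num) (by positivity)
  · have h0 : 0 ≤ max 0 (Real.log (H / ε ^ 2)) := le_max_left _ _
    exact mul_le_mul_of_nonneg_right (by norm_num) (by positivity)
  · have h1 := Dearest.ifo_bound_of_le hm' hn' hL hε hΔ0.le hκ hΔκ hmκ
    have h2 : 0 ≤ κ ^ 2 * (n + √((n : ℝ) / m) * (L / ε ^ 2)) := by positivity
    have h3 := hifo i
    linarith
  · have h1 := Dearest.comm_bound_of_le hL hε hσ0 hH0 hκ hΔκ hHκ hεκ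
    have h2 : 0 ≤ κ ^ 2 * (L / ε ^ 2 / √(1 - Dearest.lambda2 W)) := by positivity
    linarith
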